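/- For $n\ge 1$ let $NC(n)$ be the set of non-crossing partitions of $\{1,\dots,n\}$, ordered by reverse refinement, with least element $0_n$ (all blocks are singletons) and greatest element $1_n$ (one block). Let $|\pi|$ be the number of blocks of $\pi$, and let $\mathrm{Kr}(\pi)$ be its Kreweras complement, i.e. the largest $\sigma\in NC(n)$ such that $\pi\cup\sigma$ is non-crossing when $\pi$ is placed on $1,\dots,n$ and $\sigma$ on $\bar 1,\dots,\bar n$, with $1<\bar 1<2<\bar 2<\dots<n<\bar n$. Call $\pi\in NC(n)$ irreducible if it is not the concatenation of some $\pi_1\in NC(n_1)$ and $\pi_2\in NC(n_2)$ with $n_1,n_2\ge 1$, $n_1+n_2=n$. For $W\subseteq\{1,\dots,n\}$ non-empty, let $\pi_W\in NC(|W|)$ be the restriction of $\pi$ to $W$, relabeled increasingly. Complex functions on $\bigsqcup_{n\ge1}\{(\pi,\sigma):\pi\le\sigma \text{ in } NC(n)\}$ are multiplied by convolution, $(f*g)(\pi,\sigma)=\sum_{\pi\le\rho\le\sigma}f(\pi,\rho)\,g(\rho,\sigma)$. Let $\widetilde{\mathcal G}$ be the set of such functions $g$ with $g(\pi,\pi)=1$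 for all $\pi$ and $g(\pi,\sigma)=\prod_{W\in\sigma}g(\pi_W,1_{|W|})$ for all $\pi\le\sigma$ (semi-multiplicative functions). Let $\mathcal G$ be the set of those $g\in\widetilde{\mathcal G}$ with $g(\pi,1_n)=g(0_n,\mathrm{Kr}(\pi))$ for all $n\ge1$ and $\pi\in NC(n)$ (multiplicative functions). For $q\in\mathbb R$ let $u_q$ be the unique element of $\widetilde{\mathcal G}$ with $u_q(\pi,1_n)=q^{|\pi|-1}$ if $\pi\in NC(n)$ is irreducible and $u_q(\pi,1_n)=0$ otherwise (with $0^0=1$). Theorem 10.1. For every $q\in\mathbb R$ the function $u_q$ is invertible under convolution and normalizes $\mathcal G$: one has $u_q^{-1}*f*u_q\in\mathcal G$ for every $f\in\mathcal G$, and moreover $\{u_q^{-1}*f*u_q : f\in\mathcal G\}=\mathcal G$. Explicitly, if $f\in\mathcal G$ and $\lambda_n:=f(0_n,1_n)$ for $n\ge 1$, then for all $n\ge1$ and $\pi\in NC(n)$ $$(u_q^{-1}*f*u_q)(\pi,1_n)=\prod_{W\in\mathrm{Kr}(\pi)}\theta_{|W|},\qquad\text{where}\quad \theta_m=\sum_{\substack{\rho\in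 NC(m)\\ \rho\ \text{irreducible}}}q^{|\rho|-1}\prod_{V\in\rho}\lambda_{|V|}\quad(m\ge1).$$ -/

import Mathlib

/-! ### Non-crossing partitions -/

/-- A partition (given as an equivalence relation) of a linearly ordered set is non-crossing when
there are no `a < b < c < d` with `a ~ c` and `b ~ d` in two distinct blocks. -/
def IsNonCrossing {α : Type*} [LinearOrder α] (s : Setoid α) : Prop :=
  ∀ a b c d : α, a < b → b < c → c < d → s a c → s b d → s a b

/-- `NC n`: the non-crossing partitions of an `n`-element chain. The order is inherited from
`Setoid`: `π ≤ σ` means that every block of `π` is contained in a block of `σ`. -/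
abbrev NC (n : ℕ) : Type := {s : Setoid (Fin n) // IsNonCrossing s}

namespace NC

/-- `i` and `j` lie in the same block of `π`. -/
def Rel {n : ℕ} (π : NC n) (i j : Fin n) : Prop := π.1 i j

/-- `⊥` is the partition `0_n` into singletons. -/
instance (n : ℕ) : OrderBot (NC n) where
  bot := ⟨⊥, by
    intro a b c d hab hbc _ hac _
    have h : a = c := hac
    exact absurd (hab.trans hbc) (by simp [h])⟩
  bot_le π := (bot_le : (⊥ : Setoid (Fin n)) ≤ π.1)

/-- `⊤` is the partition `1_n` with a single block (for `n ≥ 1`). -/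
instance (n : ℕ) : OrderTop (NC n) where
  top := ⟨⊤, fun _ _ _ _ _ _ _ _ _ => trivial⟩
  le_top π := (le_top : π.1 ≤ (⊤ : Setoid (Fin n)))

instance (n : ℕ) : Finite (NC n) := by
  have h : Function.Injective (fun (π : NC n) (i j : Fin n) => π.1 i j) := by
    intro π σ hπσ
    apply Subtype.ext
    ext i j
    exact iff_of_eq (congrFun (congrFun hπσ i) j)
  exact Finite.of_injective _ h

noncomputable instance (n : ℕ) : Fintype (NC n) := Fintype.ofFinite _

noncomputable instance (n : ℕ) : DecidableEq (NC n) := Classical.decEq _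

open Classical in
noncomputable instance (n : ℕ) : LocallyFiniteOrder (NC n) := Fintype.toLocallyFiniteOrder

/-- The block of `π` that contains `i`. -/
noncomputable def blockOf {n : ℕ} (π : NC n) (i : Fin n) : Finset (Fin n) :=
  open Classical in Finset.univ.filter (fun j => π.Rel i j)

/-- The set of blocks of `π`. The number of blocks `|π|` is `π.blocks.card`. -/
noncomputable def blocks {n : ℕ} (π : NC n) : Finset (Finset (Fin n)) :=
  Finset.univ.image π.blockOf

theorem mem_blockOf {n : ℕ} (π : NC n) (i j : Fin n) : j ∈ π.blockOf i ↔ π.Rel i j := by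
  simp [blockOf]

theorem card_pos_of_mem_blocks {n : ℕ} {π : NC n} {W : Finset (Fin n)} (hW : W ∈ π.blocks) :
    0 < W.card := by
  obtain ⟨i, -, rfl⟩ := Finset.mem_image.1 hW
  exact Finset.card_pos.2 ⟨i, (π.mem_blockOf i i).2 (π.1.refl i)⟩

/-- The size `|W| ≥ 1` of a block `W` of `π`. -/
def blockSize {n : ℕ} {π : NC n} (W : π.blocks) : ℕ+ :=
  ⟨W.1.card, card_pos_of_mem_blocks W.2⟩

/-- The relabeled restriction `π_W` in `NC |W|`: for `W = {p_1 < ⋯ < p_m}`, the numbers `i, j` lie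
in the same block of `π_W` iff `p_i, p_j` lie in the same block of `π`. -/
def restrict {n : ℕ} (π : NC n) (W : Finset (Fin n)) : NC W.card :=
  ⟨Setoid.comap (W.orderEmbOfFin rfl) π.1, by
    intro a b c d hab hbc hcd hac hbd
    exact π.2 _ _ _ _ ((W.orderEmbOfFin rfl).lt_iff_lt.2 hab)
      ((W.orderEmbOfFin rfl).lt_iff_lt.2 hbc) ((W.orderEmbOfFin rfl).lt_iff_lt.2 hcd) hac hbd⟩

/-- The concatenation `π₁ ⋄ π₂`: place `π₁` on the first `n₁` points and `π₂` on the last `n₂`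
points. -/
def concat {n₁ n₂ : ℕ} (π₁ : NC n₁) (π₂ : NC n₂) : NC (n₁ + n₂) :=
  ⟨{ r := fun i j =>
        (∃ a b, i = Fin.castAdd n₂ a ∧ j = Fin.castAdd n₂ b ∧ π₁.Rel a b) ∨
        (∃ a b, i = Fin.natAdd n₁ a ∧ j = Fin.natAdd n₁ b ∧ π₂.Rel a b)
     iseqv := by
        refine ⟨fun i => ?_, ?_, ?_⟩
        · induction i using Fin.addCases with
          | left a => exact Or.inl ⟨a, a, rfl, rfl, π₁.1.refl a⟩
          | right a => exact Or.inr ⟨a, a, rfl, rfl, π₂.1.refl a⟩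
        · rintro i j (⟨a, b, rfl, rfl, h⟩ | ⟨a, b, rfl, rfl, h⟩)
          · exact Or.inl ⟨b, a, rfl, rfl, π₁.1.symm h⟩
          · exact Or.inr ⟨b, a, rfl, rfl, π₂.1.symm h⟩
        · rintro i j k (⟨a, b, rfl, rfl, h⟩ | ⟨a, b, rfl, rfl, h⟩)
            (⟨a', b', e, rfl, h'⟩ | ⟨a', b', e, rfl, h'⟩)
          · obtain rfl : b = a' := Fin.castAdd_injective _ _ e
            exact Or.inl ⟨a, b', rfl, rfl, π₁.1.trans h h'⟩
          · exact absurd (congrArg Fin.val e) (by simp; omega)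
          · exact absurd (congrArg Fin.val e) (by simp; omega)
          · obtain rfl : b = a' := Fin.natAdd_injective _ _ e
            exact Or.inr ⟨a, b', rfl, rfl, π₂.1.trans h h'⟩ }, by
    rintro i j k l hij hjk hkl (⟨a, b, rfl, rfl, h⟩ | ⟨a, b, rfl, rfl, h⟩)
      (⟨a', b', rfl, rfl, h'⟩ | ⟨a', b', rfl, rfl, h'⟩)
    · exact Or.inl ⟨a, a', rfl, rfl, π₁.2 a a' b b' hij hjk hkl h h'⟩
    · simp only [Fin.lt_def, Fin.val_castAdd, Fin.val_natAdd] at hij hjk hkl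
      omega
    · simp only [Fin.lt_def, Fin.val_castAdd, Fin.val_natAdd] at hij hjk hkl
      omega
    · simp only [Fin.lt_def, Fin.val_natAdd] at hij hjk hkl
      exact Or.inr ⟨a, a', rfl, rfl, π₂.2 a a' b b' (by simp only [Fin.lt_def]; omega)
        (by simp only [Fin.lt_def]; omega) (by simp only [Fin.lt_def]; omega) h h'⟩⟩

/-! ### The Kreweras complement -/

/-- The union `π ∪ σ` of a partition `π` of `{1, …, n}` and a partition `σ` of
`{1', …, n'}`, as a partition of the chain `1 < 1' < 2 < 2' < ⋯ < n < n'`. Here `i` is encoded as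
`(i, false)` and `i'` as `(i, true)`, with the lexicographic order. -/
def interlace {n : ℕ} (π σ : NC n) : Setoid (Fin n ×ₗ Bool) where
  r x y := ((ofLex x).2 = false ∧ (ofLex y).2 = false ∧ π.Rel (ofLex x).1 (ofLex y).1) ∨
    ((ofLex x).2 = true ∧ (ofLex y).2 = true ∧ σ.Rel (ofLex x).1 (ofLex y).1)
  iseqv := by
    refine ⟨fun x => ?_, ?_, ?_⟩
    · rcases h : (ofLex x).2 with _ | _
      · exact Or.inl ⟨rfl, rfl, π.1.refl _⟩
      · exact Or.inr ⟨rfl, rfl, σ.1.refl _⟩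
    · rintro x y (⟨h1, h2, h⟩ | ⟨h1, h2, h⟩)
      · exact Or.inl ⟨h2, h1, π.1.symm h⟩
      · exact Or.inr ⟨h2, h1, σ.1.symm h⟩
    · rintro x y z (⟨h1, h2, h⟩ | ⟨h1, h2, h⟩) (⟨h1', h2', h'⟩ | ⟨h1', h2', h'⟩)
      · exact Or.inl ⟨h1, h2', π.1.trans h h'⟩
      · simp [h2] at h1'
      · simp [h2] at h1'
      · exact Or.inr ⟨h1, h2', σ.1.trans h h'⟩

/-- The Kreweras complement `Kr(π)`, described explicitly: for `i < j`, the points `i'` and `j'` lie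
in the same block iff no block of `π` meets both `{i + 1, …, j}` and its complement. By
`isGreatest_kr` it is the largest `σ` such that `π ∪ σ` is non-crossing. -/
def kr {n : ℕ} (π : NC n) : NC n :=
  ⟨{ r := fun i j => ∀ a b, π.Rel a b → ((a ≤ i ↔ a ≤ j) ↔ (b ≤ i ↔ b ≤ j))
     iseqv := by
        refine ⟨fun i a b _ => by simp, fun h a b hab => ?_, fun h h' a b hab => ?_⟩
        · have := h a b hab
          tauto
        · have h1 := h a b hab
          have h2 := h' a b hab
          tauto }, by
    intro i j k l hij hjk hkl hik hjl a b hab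
    have h1 : (a ≤ i ↔ a ≤ k) ↔ (b ≤ i ↔ b ≤ k) := hik a b hab
    have h2 : (a ≤ j ↔ a ≤ l) ↔ (b ≤ j ↔ b ≤ l) := hjl a b hab
    simp only [Fin.le_def, Fin.lt_def] at *
    omega⟩

theorem kr_rel {n : ℕ} (π : NC n) (i j : Fin n) :
    π.kr.Rel i j ↔ ∀ a b, π.Rel a b → ((a ≤ i ↔ a ≤ j) ↔ (b ≤ i ↔ b ≤ j)) := Iff.rfl

end NC

/-! ### The incidence algebra of non-crossing partitions -/

/-- The poset `⊔_{n ≥ 1} NC(n)`; elements of different `NC(n)`'s are not comparable. The algebra of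
complex functions on `{(π, σ) : π ≤ σ}` under convolution is `IncidenceAlgebra ℂ NCAll`. -/
abbrev NCAll : Type := Σ n : ℕ+, NC (n : ℕ)

namespace NC

/-- The partition `0_n`, as an element of `⊔ NC(n)`. -/
def zero (n : ℕ+) : NCAll := ⟨n, ⊥⟩

/-- The partition `1_n`, as an element of `⊔ NC(n)`. -/
def one (n : ℕ+) : NCAll := ⟨n, ⊤⟩

/-- `π ∈ NC(n)` is irreducible when it is not of the form `π₁ ⋄ π₂` with `π₁ ∈ NC(n₁)`,
`π₂ ∈ NC(n₂)`, `n₁, n₂ ≥ 1`, `n₁ + n₂ = n`. -/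
def IsIrreducible {n : ℕ+} (π : NC n) : Prop :=
  ¬ ∃ (n₁ n₂ : ℕ+) (π₁ : NC n₁) (π₂ : NC n₂),
    (⟨n₁ + n₂, concat π₁ π₂⟩ : NCAll) = ⟨n, π⟩

/-- For a block `W` of `σ`, the relabeled restriction `π_W`, as an element of `⊔ NC(n)`. -/
def restrictBlock {n : ℕ} (π : NC n) {σ : NC n} (W : σ.blocks) : NCAll :=
  ⟨blockSize W, π.restrict W.1⟩

end NC

open NC in
/-- The set `𝒢̃` of unitized semi-multiplicative functions. -/
def semiMultiplicative : Set (IncidenceAlgebra ℂ NCAll) :=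
  {g | (∀ a : NCAll, g a a = 1) ∧
    ∀ (n : ℕ+) (π σ : NC n), π ≤ σ →
      g ⟨n, π⟩ ⟨n, σ⟩ = ∏ W : σ.blocks, g (π.restrictBlock W) (one (blockSize W))}

open NC in
/-- The set `𝒢` of (unitized) multiplicative functions. -/
def multiplicative : Set (IncidenceAlgebra ℂ NCAll) :=
  {g | g ∈ semiMultiplicative ∧
    ∀ (n : ℕ+) (π : NC n), g ⟨n, π⟩ (one n) = g (zero n) ⟨n, π.kr⟩}

open NC Classical in
/-- The function `g(π, σ) = ∏_{W ∈ σ} z(π_W)` for `π ≤ σ`, where `z : ⊔ NC(n) → ℂ`. -/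
noncomputable def ofValues (z : NCAll → ℂ) : IncidenceAlgebra ℂ NCAll where
  toFun a b :=
    if h : a.1 = b.1 then
      if (h ▸ a.2 : NC b.1) ≤ b.2 then
        ∏ W : b.2.blocks, z ((h ▸ a.2 : NC b.1).restrictBlock W)
      else 0
    else 0
  eq_zero_of_not_le' := by
    rintro ⟨n, π⟩ ⟨m, σ⟩ hab
    by_cases h : n = m
    · subst h
      have : ¬ π ≤ σ := fun hle => hab (Sigma.mk_le_mk_iff.2 hle)
      simp [this]
    · simp [h]

open NC Classical in
/-- The function `u_q`: the semi-multiplicative function with `u_q(π, 1_n) = q^{|π| - 1}` for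
irreducible `π` and `u_q(π, 1_n) = 0` otherwise; see `uFun_mem`, `uFun_one` and `uFun_unique`. -/
noncomputable def uFun (q : ℝ) : IncidenceAlgebra ℂ NCAll :=
  ofValues fun a => if a.2.IsIrreducible then (q : ℂ) ^ (a.2.blocks.card - 1) else 0

open NC Classical in
/-- `θ_n = ∑_{π ∈ NC(n) irreducible} q^{|π| - 1} ∏_{V ∈ π} λ_{|V|}`. -/
noncomputable def theta (q : ℝ) (lam : ℕ+ → ℂ) (n : ℕ+) : ℂ :=
  ∑ π ∈ Finset.univ.filter (fun π : NC n => π.IsIrreducible),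
    (q : ℂ) ^ (π.blocks.card - 1) * ∏ V : π.blocks, lam (blockSize V)

namespace NC

/-- The Kreweras complement is the largest `σ` for which `π ∪ σ` is non-crossing. -/
theorem isGreatest_kr {n : ℕ} (π : NC n) :
    IsGreatest {σ : NC n | IsNonCrossing (interlace π σ)} π.kr := by
  constructor
  · rintro ⟨a, s⟩ ⟨b, t⟩ ⟨c, s'⟩ ⟨d, t'⟩ hab hbc hcd hac hbd
    change toLex (a, s) < toLex (b, t) at hab
    change toLex (b, t) < toLex (c, s') at hbc
    change toLex (c, s') < toLex (d, t') at hcd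
    rw [Prod.Lex.toLex_lt_toLex] at hab hbc hcd
    change (s = false ∧ s' = false ∧ π.Rel a c) ∨ (s = true ∧ s' = true ∧ π.kr.Rel a c) at hac
    change (t = false ∧ t' = false ∧ π.Rel b d) ∨ (t = true ∧ t' = true ∧ π.kr.Rel b d) at hbd
    change (s = false ∧ t = false ∧ π.Rel a b) ∨ (s = true ∧ t = true ∧ π.kr.Rel a b)
    rcases hac with ⟨rfl, rfl, hac⟩ | ⟨rfl, rfl, hac⟩ <;>
      rcases hbd with ⟨rfl, rfl, hbd⟩ | ⟨rfl, rfl, hbd⟩ <;>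
      simp [show ¬ (true < false) by decide] at hab hbc hcd
    · exact Or.inl ⟨rfl, rfl, π.2 a b c d hab hbc hcd hac hbd⟩
    · have h : (a ≤ b ↔ a ≤ d) ↔ (c ≤ b ↔ c ≤ d) := hbd a c hac
      simp only [Fin.lt_def, Fin.le_def, Fin.ext_iff] at hab hbc hcd h
      omega
    · have h : (b ≤ a ↔ b ≤ c) ↔ (d ≤ a ↔ d ≤ c) := hac b d hbd
      simp only [Fin.lt_def, Fin.le_def, Fin.ext_iff] at hab hbc hcd h
      omega
    · exact Or.inr ⟨rfl, rfl, π.kr.2 a b c d hab hbc hcd hac hbd⟩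
  · intro σ hσ
    have key : ∀ i j a b : Fin n, σ.Rel i j → π.Rel a b → i < a → a ≤ j → i < b ∧ b ≤ j := by
      intro i j a b hij hab hia haj
      by_contra hb
      rcases le_or_gt b i with hbi | hbi
      · have := hσ (toLex (b, false)) (toLex (i, true)) (toLex (a, false)) (toLex (j, true))
          (by rw [Prod.Lex.toLex_lt_toLex]; simpa using hbi.lt_or_eq)
          (by rw [Prod.Lex.toLex_lt_toLex]; exact Or.inl hia)
          (by rw [Prod.Lex.toLex_lt_toLex]; simpa using haj.lt_or_eq)
          (Or.inl ⟨rfl, rfl, π.1.symm hab⟩) (Or.inr ⟨rfl, rfl, hij⟩)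
        rcases this with ⟨_, h, _⟩ | ⟨h, _, _⟩ <;> simp at h
      · have hjb : j < b := by
          by_contra h
          exact hb ⟨hbi, not_lt.1 h⟩
        have := hσ (toLex (i, true)) (toLex (a, false)) (toLex (j, true)) (toLex (b, false))
          (by rw [Prod.Lex.toLex_lt_toLex]; exact Or.inl hia)
          (by rw [Prod.Lex.toLex_lt_toLex]; simpa using haj.lt_or_eq)
          (by rw [Prod.Lex.toLex_lt_toLex]; exact Or.inl hjb)
          (Or.inr ⟨rfl, rfl, hij⟩) (Or.inl ⟨rfl, rfl, hab⟩)
        rcases this with ⟨h, _, _⟩ | ⟨_, h, _⟩ <;> simp at h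
    intro i j hij a b hab
    have h1 := key i j a b hij hab
    have h2 := key i j b a hij (π.1.symm hab)
    have h3 := key j i a b (σ.1.symm hij) hab
    have h4 := key j i b a (σ.1.symm hij) (π.1.symm hab)
    simp only [Fin.le_def, Fin.lt_def] at *
    omega

theorem comap_eq {k n : ℕ+} (h : k = n) (π : NC n) (e : Fin k ↪o Fin n)
    (he : IsNonCrossing (Setoid.comap e π.1)) :
    (⟨k, ⟨Setoid.comap e π.1, he⟩⟩ : NCAll) = ⟨n, π⟩ := by
  subst h
  obtain rfl : e = RelEmbedding.refl _ := by
    have hs : Function.Surjective e := Finite.surjective_of_injective e.injective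
    have h : RelIso.ofSurjective e hs = RelIso.refl _ := Subsingleton.elim _ _
    ext x
    exact congrArg Fin.val (congrFun (congrArg DFunLike.coe h) x)
  rfl

theorem restrictBlock_top {n : ℕ+} (π : NC n) (W : (⊤ : NC n).blocks) :
    π.restrictBlock W = ⟨n, π⟩ := by
  apply comap_eq
  apply PNat.eq
  obtain ⟨i, -, hi⟩ := Finset.mem_image.1 W.2
  have hW : W.1 = Finset.univ := by
    rw [← hi]
    ext j
    simp only [mem_blockOf, Finset.mem_univ, iff_true]
    exact trivial
  change W.1.card = n
  rw [hW, Finset.card_univ, Fintype.card_fin]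

theorem restrictBlock_self {n : ℕ} (σ : NC n) (W : σ.blocks) :
    σ.restrictBlock W = one (blockSize W) := by
  obtain ⟨W, hW⟩ := W
  obtain ⟨i, -, rfl⟩ := Finset.mem_image.1 hW
  have h : σ.restrict (σ.blockOf i) = ⊤ := by
    apply top_unique
    intro a b _
    have ha := (σ.mem_blockOf i _).1 ((σ.blockOf i).orderEmbOfFin_mem rfl a)
    have hb := (σ.mem_blockOf i _).1 ((σ.blockOf i).orderEmbOfFin_mem rfl b)
    exact σ.1.trans (σ.1.symm ha) hb
  exact congrArg (Sigma.mk (blockSize ⟨σ.blockOf i, hW⟩)) h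

theorem isIrreducible_top (n : ℕ+) : (⊤ : NC n).IsIrreducible := by
  rintro ⟨n₁, n₂, π₁, π₂, h⟩
  obtain ⟨h1, h2⟩ := Sigma.mk.inj_iff.1 h
  subst h1
  have h3 : concat π₁ π₂ = ⊤ := eq_of_heq h2
  have h4 : (concat π₁ π₂).Rel (Fin.castAdd n₂ ⟨0, n₁.pos⟩) (Fin.natAdd n₁ ⟨0, n₂.pos⟩) := by
    rw [h3]
    exact trivial
  rcases h4 with ⟨a, b, -, h, -⟩ | ⟨a, b, h, -, -⟩
  · have := congrArg Fin.val h
    have := b.2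
    simp at *
    omega
  · have := congrArg Fin.val h
    have hn := n₁.pos
    simp only [Fin.val_castAdd, Fin.val_natAdd] at this
    omega

theorem card_blocks_top (n : ℕ+) : (⊤ : NC n).blocks.card = 1 := by
  have h : ∀ i, (⊤ : NC n).blockOf i = Finset.univ := by
    intro i
    ext j
    simp only [mem_blockOf, Finset.mem_univ, iff_true]
    exact trivial
  rw [Finset.card_eq_one]
  refine ⟨Finset.univ, ?_⟩
  ext W
  simp only [blocks, Finset.mem_image, Finset.mem_univ, true_and, Finset.mem_singleton, h]
  exact ⟨fun ⟨_, hi⟩ => hi.symm, fun hW => ⟨⟨0, n.pos⟩, hW.symm⟩⟩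

end NC

theorem ofValues_apply (z : NCAll → ℂ) {n : ℕ+} {π σ : NC n} (h : π ≤ σ) :
    ofValues z ⟨n, π⟩ ⟨n, σ⟩ = ∏ W : σ.blocks, z (π.restrictBlock W) := by
  change (if h : n = n then _ else _) = _
  simp [h]

theorem ofValues_one (z : NCAll → ℂ) (n : ℕ+) (π : NC n) :
    ofValues z ⟨n, π⟩ (NC.one n) = z ⟨n, π⟩ := by
  rw [NC.one, ofValues_apply z le_top]
  simp only [NC.restrictBlock_top, Finset.prod_const]
  rw [Finset.card_univ, Fintype.card_coe, NC.card_blocks_top, pow_one]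

/-- Prescribed values `g(π, 1_n) = z(π)`, subject to `z(1_n) = 1`, give a function in `𝒢̃`. -/
theorem ofValues_mem (z : NCAll → ℂ) (hz : ∀ n, z (NC.one n) = 1) :
    ofValues z ∈ semiMultiplicative := by
  refine ⟨?_, ?_⟩
  · rintro ⟨n, π⟩
    rw [ofValues_apply z le_rfl]
    exact Finset.prod_eq_one fun W _ => by rw [NC.restrictBlock_self, hz]
  · intro n π σ h
    rw [ofValues_apply z h]
    exact Finset.prod_congr rfl fun W _ => (ofValues_one z _ _).symm

theorem uFun_mem (q : ℝ) : uFun q ∈ semiMultiplicative := by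
  apply ofValues_mem
  intro n
  have h : (NC.one n).2.IsIrreducible := NC.isIrreducible_top n
  have h' : (NC.one n).2.blocks.card = 1 := NC.card_blocks_top n
  rw [if_pos h, h', Nat.sub_self, pow_zero]

open Classical in
theorem uFun_one (q : ℝ) (n : ℕ+) (π : NC n) :
    uFun q ⟨n, π⟩ (NC.one n) =
      if π.IsIrreducible then (q : ℂ) ^ (π.blocks.card - 1) else 0 :=
  ofValues_one _ n π

theorem uFun_unique (q : ℝ) (g : IncidenceAlgebra ℂ NCAll) (hg : g ∈ semiMultiplicative)
    (h : ∀ (n : ℕ+) (π : NC n), g ⟨n, π⟩ (NC.one n) = uFun q ⟨n, π⟩ (NC.one n)) :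
    g = uFun q := by
  ext a b hab
  obtain ⟨n, π, σ, h'⟩ := hab
  rw [hg.2 n π σ h', (uFun_mem q).2 n π σ h']
  exact Finset.prod_congr rfl fun W _ => h _ _

/-! ### Extremal elements of blocks and the Kreweras complement -/

/-! Since `u_q` is invertible, it suffices to show `f * u_q = u_q * g`, where `g` is the
multiplicative function with sequence `θ`. Both sides are semi-multiplicative, so only their values
at `(π, 1_n)` matter.

A multiplicative `f` takes at `(π, ρ)` the product of the `λ`'s over the blocks of the relative
complement `relKr π ρ`. Hence the left side is a sum over irreducible `ρ ≥ π`, with weight `q ^ (|ρ|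
- 1)`. On the right, `u_q (π, σ)` is `q ^ (|π| - |σ|)` if `π ≪ σ` (`Dominated`) and zero otherwise.
Expanding each `θ` over the blocks of `Kr σ` gives a sum over pairs `(σ, τ)` with `π ≪ σ` and `τ ≪
Kr σ`.

The terms are matched by `τ = relKr π ρ`. The map `ρ ↦ relKr π ρ` is a bijection from the partitions
above `π` onto those below `Kr π` (`relKr_injective`, `exists_relKr_eq`). Irreducibility of `ρ`
means that some `M` is joined to the first point by `π` and to the last point by `τ`. Exactly then a
suitable `σ` exists (`exists_dominated`, `Dominated.exists_middle`), and it is unique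
(`Dominated.unique`). The powers of `q` agree because `|π| + |τ| = n + |ρ|` and `|σ| + |Kr σ| = n +
1`.

That conjugation is onto follows from triangularity: `θ_n` is `λ_n` plus an expression in the `λ_k`
with `k < n`. -/

theorem exists_greatest_of_finite {α : Type*} [LinearOrder α] [Finite α] (p : α → Prop) {i : α}
    (h : p i) : ∃ M, p M ∧ ∀ j, p j → j ≤ M := by
  obtain ⟨M, hM, h'⟩ := (Set.toFinite {x | p x}).exists_maximalFor id _ ⟨i, h⟩
  exact ⟨M, hM, fun j hj => (le_total j M).elim id (fun hMj => h' hj hMj)⟩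

theorem exists_least_of_finite {α : Type*} [LinearOrder α] [Finite α] (p : α → Prop) {i : α}
    (h : p i) : ∃ m, p m ∧ ∀ j, p j → m ≤ j :=
  exists_greatest_of_finite (α := αᵒᵈ) p h

namespace NC

variable {n : ℕ}

theorem Rel.symm {π : NC n} {i j : Fin n} (h : π.Rel i j) : π.Rel j i := π.1.symm h

theorem Rel.trans {π : NC n} {i j k : Fin n} (h : π.Rel i j) (h' : π.Rel j k) : π.Rel i k :=
  π.1.trans h h'

theorem Rel.rfl {π : NC n} {i : Fin n} : π.Rel i i := π.1.refl i

theorem Rel.mono {π σ : NC n} (h : π ≤ σ) {i j : Fin n} (hij : π.Rel i j) : σ.Rel i j := h hij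

theorem rel_of_crossing (π : NC n) {a b c d : Fin n} (hab : a < b) (hbc : b < c) (hcd : c < d)
    (hac : π.Rel a c) (hbd : π.Rel b d) : π.Rel a b := π.2 a b c d hab hbc hcd hac hbd

theorem le_def {π σ : NC n} : π ≤ σ ↔ ∀ i j, π.Rel i j → σ.Rel i j :=
  ⟨fun h _ _ hij => h hij, fun h i j hij => h i j hij⟩

theorem le_of_rel_of_lt {π σ : NC n} (h : ∀ i j, i < j → π.Rel i j → σ.Rel i j) : π ≤ σ := by
  rw [le_def]
  intro i j hij
  rcases lt_trichotomy i j with hlt | rfl | hlt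
  · exact h i j hlt hij
  · exact Rel.rfl
  · exact (h j i hlt hij.symm).symm

/-- For `i ≤ j`, the complement joins `i` and `j` iff `(i, j]` is a union of blocks of `π`. -/
theorem kr_rel_of_le {π : NC n} {i j : Fin n} (hij : i ≤ j) :
    π.kr.Rel i j ↔ ∀ a b, π.Rel a b → i < a → a ≤ j → i < b ∧ b ≤ j := by
  rw [kr_rel]
  constructor
  · intro h a b hab hia haj
    have := h a b hab
    grind
  · intro h a b hab
    have h1 := h a b hab
    have h2 := h b a hab.symm
    grind

theorem exists_max (π : NC n) (i : Fin n) :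
    ∃ M, π.Rel i M ∧ ∀ j, π.Rel i j → j ≤ M := exists_greatest_of_finite _ (Rel.rfl (i := i))

theorem exists_min (π : NC n) (i : Fin n) :
    ∃ m, π.Rel i m ∧ ∀ j, π.Rel i j → m ≤ j := exists_least_of_finite _ (Rel.rfl (i := i))

/-- An interval between the extremal elements of a block is a union of blocks. -/
theorem closed_of_min_max {π : NC n} {m M : Fin n} (hmM : π.Rel m M) (hm : ∀ j, π.Rel m j → m ≤ j)
    (hM : ∀ j, π.Rel m j → j ≤ M) {a b : Fin n} (hab : π.Rel a b) (hma : m ≤ a) (haM : a ≤ M) :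
    m ≤ b ∧ b ≤ M := by
  by_cases ha : π.Rel m a
  · exact ⟨hm b (ha.trans hab), hM b (ha.trans hab)⟩
  have h1 : m < a := lt_of_le_of_ne hma (by rintro rfl; exact ha Rel.rfl)
  have h2 : a < M := lt_of_le_of_ne haM (by rintro rfl; exact ha hmM)
  constructor
  · by_contra hb
    exact ha ((π.rel_of_crossing (not_le.1 hb) h1 h2 hab.symm hmM).symm.trans hab.symm)
  · by_contra hb
    exact ha (π.rel_of_crossing h1 h2 (not_le.1 hb) hmM hab)

/-- Here `w` is the predecessor of `m`, so `(w, M]` is the interval `[m, M]` spanned by a block.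
This is the main source of pairs joined by the complement. -/
theorem kr_rel_of_min_max {π : NC n} {w m M : Fin n} (hw : ∀ x, w < x ↔ m ≤ x) (hmM : π.Rel m M)
    (hm : ∀ j, π.Rel m j → m ≤ j) (hM : ∀ j, π.Rel m j → j ≤ M) : π.kr.Rel w M := by
  have hwM : w < M := (hw M).2 (hm M hmM)
  rw [kr_rel_of_le hwM.le]
  intro a b hab ha haM
  have := closed_of_min_max hmM hm hM hab ((hw a).1 ha) haM
  exact ⟨(hw b).2 this.1, this.2⟩

theorem kr_antitone {π σ : NC n} (h : π ≤ σ) : σ.kr ≤ π.kr :=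
  le_def.2 fun _ _ hij a b hab => hij a b (hab.mono h)

theorem exists_pred_of_lt {i m : Fin n} (h : i < m) : ∃ w : Fin n, ∀ x, w < x ↔ m ≤ x :=
  ⟨⟨m - 1, by omega⟩, fun x => by simp only [Fin.lt_def, Fin.le_def] at *; omega⟩

/-- An open interval between neighbouring elements of a block is a union of blocks. -/
theorem closed_of_neighbours {π : NC n} {p r : Fin n} (hpr : π.Rel p r)
    (h : ∀ x, π.Rel p x → p < x → r ≤ x) {a b : Fin n} (hab : π.Rel a b) (hpa : p < a)
    (har : a < r) : p < b ∧ b < r := by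
  have ha : ¬ π.Rel p a := fun hp => absurd (h a hp hpa) (not_le.2 har)
  have hbp : b ≠ p := by rintro rfl; exact ha hab.symm
  have hbr : b ≠ r := by rintro rfl; exact ha (hpr.trans hab.symm)
  constructor
  · by_contra hb
    have hb' : b < p := lt_of_le_of_ne (not_lt.1 hb) hbp
    exact ha ((π.rel_of_crossing hb' hpa har hab.symm hpr).symm.trans hab.symm)
  · by_contra hb
    have hb' : r < b := lt_of_le_of_ne (not_lt.1 hb) hbr.symm
    exact ha (π.rel_of_crossing hpa har hb' hpr hab)

/-- This recovers `π` from its complement. If `i` and `j` were not joined, the block of `j` would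
either have neighbouring elements on both sides of `i` or lie entirely to the right of `i`. In each
case a gap next to that block gives a pair joined by the complement with just one member in `[i,
j)`. -/
theorem rel_of_kr_closed {π : NC n} {i j : Fin n} (hij : i < j)
    (h : ∀ a b, π.kr.Rel a b → i ≤ a → a < j → i ≤ b ∧ b < j) : π.Rel i j := by
  by_contra hne
  by_cases hlow : ∃ p, π.Rel j p ∧ p < i
  · obtain ⟨p₀, hp₀, hp₀i⟩ := hlow
    obtain ⟨p, ⟨hjp, hpi⟩, hp⟩ :=
      exists_greatest_of_finite (fun x => π.Rel j x ∧ x < i) ⟨hp₀, hp₀i⟩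
    obtain ⟨r, ⟨hjr, hir⟩, hr⟩ :=
      exists_least_of_finite (fun x => π.Rel j x ∧ i < x) ⟨Rel.rfl, hij⟩
    obtain ⟨w, hw⟩ := exists_pred_of_lt hir
    have hrj : r ≤ j := hr j ⟨Rel.rfl, hij⟩
    have hiw : i ≤ w := by
      by_contra hiw
      exact absurd ((hw i).1 (not_le.1 hiw)) (not_le.2 hir)
    have hwr : w < r := (hw r).2 le_rfl
    have hkr : π.kr.Rel p w := by
      rw [kr_rel_of_le (hpi.le.trans hiw)]
      intro a b hab hpa haw
      have := closed_of_neighbours (hjp.symm.trans hjr) (fun x hx hpx => ?_) hab hpa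
        (lt_of_le_of_lt haw hwr)
      · refine ⟨this.1, ?_⟩
        by_contra hb
        exact absurd ((hw b).1 (not_le.1 hb)) (not_le.2 this.2)
      · rcases lt_trichotomy x i with hxi | rfl | hxi
        · exact absurd (hp x ⟨hjp.trans hx, hxi⟩) (not_le.2 hpx)
        · exact absurd (hjp.trans hx).symm hne
        · exact hr x ⟨hjp.trans hx, hxi⟩
    exact absurd (h w p hkr.symm hiw (lt_of_lt_of_le hwr hrj)).1 (not_le.2 hpi)
  · obtain ⟨m, hm, hm'⟩ := π.exists_min j
    obtain ⟨M, hM, hM'⟩ := π.exists_max j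
    have him : i < m := by
      rcases lt_trichotomy i m with h | rfl | h
      · exact h
      · exact absurd hm.symm hne
      · exact absurd ⟨m, hm, h⟩ hlow
    obtain ⟨w, hw⟩ := exists_pred_of_lt him
    have hiw : i ≤ w := by
      by_contra hiw
      exact absurd ((hw i).1 (not_le.1 hiw)) (not_le.2 him)
    have hkr : π.kr.Rel w M := kr_rel_of_min_max hw (hm.symm.trans hM)
      (fun x hx => hm' x (hm.trans hx)) (fun x hx => hM' x (hm.trans hx))
    have hmj : m ≤ j := hm' j Rel.rfl
    exact absurd (h w M hkr hiw (lt_of_lt_of_le ((hw m).2 le_rfl) hmj)).2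
      (not_lt.2 (hM' j Rel.rfl))

theorem le_of_kr_le {π σ : NC n} (h : σ.kr ≤ π.kr) : π ≤ σ := by
  refine le_of_rel_of_lt fun i j hij hπ => rel_of_kr_closed hij fun a b hab hia haj => ?_
  have h1 := (kr_rel π a b).1 (hab.mono h) i j hπ
  grind

theorem kr_injective : Function.Injective (kr : NC n → NC n) := fun _ _ h =>
  le_antisymm (le_of_kr_le h.ge) (le_of_kr_le h.le)

theorem kr_bijective : Function.Bijective (kr : NC n → NC n) :=
  Finite.injective_iff_bijective.1 kr_injective

/-! ### The relative Kreweras complement -/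

theorem isNonCrossing_inf {α : Type*} [LinearOrder α] {s t : Setoid α} (hs : IsNonCrossing s)
    (ht : IsNonCrossing t) : IsNonCrossing (s ⊓ t) := fun a b c d hab hbc hcd hac hbd =>
  ⟨hs a b c d hab hbc hcd hac.1 hbd.1, ht a b c d hab hbc hcd hac.2 hbd.2⟩

/-- The complement of `π` relative to `ρ ≥ π`: the Kreweras complement inside each block of `ρ`. -/
def relKr (π ρ : NC n) : NC n := ⟨π.kr.1 ⊓ ρ.1, isNonCrossing_inf π.kr.2 ρ.2⟩

theorem relKr_rel {π ρ : NC n} {i j : Fin n} :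
    (relKr π ρ).Rel i j ↔ π.kr.Rel i j ∧ ρ.Rel i j := Iff.rfl

theorem relKr_le_kr (π ρ : NC n) : relKr π ρ ≤ π.kr := le_def.2 fun _ _ h => h.1

theorem relKr_le (π ρ : NC n) : relKr π ρ ≤ ρ := le_def.2 fun _ _ h => h.2

/-- In other words, `ρ` is generated by `π` and `relKr π ρ`, and so is determined by the latter.
Neighbours `w < j` in a block of `ρ` are linked by one step of each: through the previous element
`p` of the `π`-block of `j`, or, if `j` is least in that block, through its greatest element `M`. -/
theorem le_of_relKr_le {π ρ ρ' : NC n} (hπρ : π ≤ ρ) (hπ : π ≤ ρ')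
    (hK : relKr π ρ ≤ ρ') : ρ ≤ ρ' := by
  rw [le_def] at *
  have key : ∀ w j, w < j → ρ.Rel w j → (∀ x, ρ.Rel w x → w < x → j ≤ x) → ρ'.Rel w j := by
    intro w j hwj hρ hnext
    have hclosed : ∀ {a b}, π.Rel a b → w < a → a < j → w < b ∧ b < j :=
      fun hab => closed_of_neighbours hρ hnext (hπρ _ _ hab)
    have hsep : ∀ {b}, π.Rel j b → w < b → j ≤ b := fun hb => hnext _ (hρ.trans (hπρ _ _ hb))
    by_cases hlow : ∃ p, π.Rel j p ∧ p < j
    · obtain ⟨p₀, hp₀⟩ := hlow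
      obtain ⟨p, ⟨hjp, hpj⟩, hp⟩ :=
        exists_greatest_of_finite (fun x => π.Rel j x ∧ x < j) hp₀
      have hpw : p ≤ w := by
        by_contra hpw
        exact absurd (hsep hjp (not_le.1 hpw)) (not_le.2 hpj)
      have hτ : (relKr π ρ).Rel p w := by
        refine relKr_rel.2 ⟨?_, (hπρ _ _ hjp).symm.trans hρ.symm⟩
        rw [kr_rel_of_le hpw]
        intro a b hab hpa haw
        have h1 := closed_of_neighbours hjp.symm (fun x hx hpx => ?_) hab hpa
          (lt_of_le_of_lt haw hwj)
        · refine ⟨h1.1, ?_⟩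
          by_contra hb
          exact absurd (hclosed hab.symm (not_le.1 hb) h1.2).1 (not_lt.2 haw)
        · by_contra hxj
          exact absurd (hp x ⟨hjp.trans hx, not_le.1 hxj⟩) (not_le.2 hpx)
      exact (hK _ _ hτ).symm.trans (hπ _ _ hjp.symm)
    · obtain ⟨M, hM, hM'⟩ := π.exists_max j
      have hτ : (relKr π ρ).Rel w M := by
        refine relKr_rel.2 ⟨?_, hρ.trans (hπρ _ _ hM)⟩
        have hjM := hM' j Rel.rfl
        rw [kr_rel_of_le (hwj.le.trans hjM)]
        intro a b hab hwa haM
        rcases lt_or_ge a j with haj | hja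
        · have := hclosed hab hwa haj
          exact ⟨this.1, this.2.le.trans hjM⟩
        · have := closed_of_min_max hM (fun x hx => ?_) hM' hab hja haM
          · exact ⟨lt_of_lt_of_le hwj this.1, this.2⟩
          · by_contra hxj
            exact hlow ⟨x, hx, not_le.1 hxj⟩
      exact (hK _ _ hτ).trans (hπ _ _ hM.symm)
  -- Any pair in a block is a chain of neighbours; the induction on the right end peels off the last
  -- link.
  suffices H : ∀ (k : ℕ) (i j : Fin n), (j : ℕ) = k → i < j → ρ.Rel i j → ρ'.Rel i j by
    exact fun i j => le_of_rel_of_lt (fun i j hij => H j i j rfl hij) (x := i) (y := j)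
  intro k
  induction k using Nat.strong_induction_on with
  | _ k ih =>
    intro i j hk hij hρ
    obtain ⟨w, ⟨hw, hwj⟩, hw'⟩ := exists_greatest_of_finite (fun x => ρ.Rel i x ∧ x < j)
      ⟨Rel.rfl, hij⟩
    have hwρ : ρ'.Rel w j := by
      refine key w j hwj (hw.symm.trans hρ) fun x hx hwx => ?_
      by_contra hxj
      exact absurd (hw' x ⟨hw.trans hx, not_le.1 hxj⟩) (not_le.2 hwx)
    rcases (hw' i ⟨Rel.rfl, hij⟩).eq_or_lt with rfl | hiw
    · exact hwρ
    · exact (ih w (by omega) i w rfl hiw hw).trans hwρ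

theorem relKr_injective {π ρ ρ' : NC n} (hρ : π ≤ ρ) (hρ' : π ≤ ρ')
    (h : relKr π ρ = relKr π ρ') : ρ = ρ' :=
  le_antisymm (le_of_relKr_le hρ hρ' (h ▸ relKr_le π ρ'))
    (le_of_relKr_le hρ' hρ (h ▸ relKr_le π ρ))

/-- No inverse is constructed. The ordinary complement already shows that there are as many
partitions above `π` as below `π.kr`, so the injection `relKr π` between these finite sets is onto.
-/
theorem exists_relKr_eq {π τ : NC n} (h : τ ≤ π.kr) : ∃ ρ, π ≤ ρ ∧ relKr π ρ = τ := by
  let e : {ρ : NC n // π ≤ ρ} → {τ : NC n // τ ≤ π.kr} := fun ρ => ⟨relKr π ρ, relKr_le_kr π ρ⟩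
  let k : {ρ : NC n // π ≤ ρ} → {τ : NC n // τ ≤ π.kr} := fun ρ => ⟨ρ.1.kr, kr_antitone ρ.2⟩
  have hk : Function.Bijective k := by
    refine ⟨fun ρ ρ' h => Subtype.ext (kr_injective (congrArg Subtype.val h)), fun τ => ?_⟩
    obtain ⟨ρ, hρ⟩ := kr_bijective.2 τ.1
    exact ⟨⟨ρ, le_of_kr_le (hρ.le.trans τ.2)⟩, Subtype.ext hρ⟩
  have he : Function.Injective e := fun ρ ρ' h =>
    Subtype.ext (relKr_injective ρ.2 ρ'.2 (congrArg Subtype.val h))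
  obtain ⟨ρ, hρ⟩ := (he.bijective_of_nat_card_le (Nat.card_eq_of_bijective k hk).ge).2 ⟨τ, h⟩
  exact ⟨ρ.1, ρ.2, congrArg Subtype.val hρ⟩

end NC

/-! ### Merging blocks of the same colour -/

section Merge

variable {α : Type*} [LinearOrder α] {ω : Setoid α} {c : α → Bool}

/-- For a coloured partition `ω`: the block of `x` covers `i` and is of the colour of `i`, and no
arc of the other colour that starts after `x` covers `i`. -/
def ColorCovers (ω : Setoid α) (c : α → Bool) (x i : α) : Prop :=
  x ≤ i ∧ c x = c i ∧ (∃ y, i ≤ y ∧ ω x y) ∧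
    ∀ s t, ω s t → c s ≠ c i → x < s → s < i → ¬ i < t

theorem ColorCovers.refl (i : α) : ColorCovers ω c i i :=
  ⟨le_rfl, rfl, ⟨i, le_rfl, ω.refl i⟩, fun _ _ _ _ h h' => absurd h h'.not_gt⟩

theorem ColorCovers.trans (hω : IsNonCrossing ω) {x y z : α}
    (h : ColorCovers ω c x y) (h' : ColorCovers ω c y z) : ColorCovers ω c x z := by
  obtain ⟨hxy, hcxy, ⟨x', hx', hxx'⟩, hb⟩ := h
  obtain ⟨hyz, hcyz, ⟨y', hy', hyy'⟩, hb'⟩ := h'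
  refine ⟨hxy.trans hyz, hcxy.trans hcyz, ?_, ?_⟩
  · by_cases hzx : z ≤ x'
    · exact ⟨x', hzx, hxx'⟩
    refine ⟨y', hy', ω.trans ?_ hyy'⟩
    rcases hxy.eq_or_lt with rfl | hxy
    · exact ω.refl _
    rcases hx'.eq_or_lt with rfl | hx'
    · exact hxx'
    · exact hω x y x' y' hxy hx' (lt_of_lt_of_le (not_le.1 hzx) hy') hxx' hyy'
  · intro s t hst hcs hxs hsz hzt
    rcases lt_trichotomy s y with hsy | rfl | hys
    · exact hb s t hst (hcyz ▸ hcs) hxs hsy (lt_of_le_of_lt hyz hzt)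
    · exact hcs hcyz
    · exact hb' s t hst hcs hys hsz hzt

/-- The points covering a fixed `j` thus form a chain, which makes `colorMerge` transitive. An
offending arc over `x'` either ends before `j` and crosses the block of `x'`, or passes over `j` and
contradicts the covering of `j` by `x`. -/
theorem ColorCovers.of_le (hω : IsNonCrossing ω) (hc : ∀ a b, ω a b → c a = c b) {x x' j : α}
    (h : ColorCovers ω c x j) (h' : ColorCovers ω c x' j) (hxx' : x ≤ x') :
    ColorCovers ω c x x' := by
  obtain ⟨hxj, hcxj, ⟨y, hy, hxy⟩, hb⟩ := h
  obtain ⟨hx'j, hcx'j, ⟨y', hy', hxy'⟩, hb'⟩ := h'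
  refine ⟨hxx', hcxj.trans hcx'j.symm, ⟨y, hx'j.trans hy, hxy⟩, ?_⟩
  intro s t hst hcs hxs hsx ht
  have hcs' : c s ≠ c j := fun e => hcs (e.trans hcx'j.symm)
  rcases lt_trichotomy t j with htj | rfl | hjt
  · exact hcs (hc _ _ (hω s x' t y' hsx ht (lt_of_lt_of_le htj hy') hst hxy'))
  · exact hcs' (hc _ _ hst)
  · exact hb s t hst hcs' hxs (lt_of_lt_of_le hsx hx'j) hjt

/-- The partition obtained from a coloured non-crossing partition by merging each block with the
innermost block that covers it whenever the two have the same colour. -/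
def colorMerge (hω : IsNonCrossing ω) (hc : ∀ a b, ω a b → c a = c b) : Setoid α where
  r i j := ∃ x, ColorCovers ω c x i ∧ ColorCovers ω c x j
  iseqv := by
    refine ⟨fun i => ⟨i, .refl i, .refl i⟩, fun ⟨x, h, h'⟩ => ⟨x, h', h⟩, ?_⟩
    rintro i j k ⟨x, hi, hj⟩ ⟨x', hj', hk⟩
    rcases le_total x x' with h | h
    · exact ⟨x, hi, (hj.of_le hω hc hj' h).trans hω hk⟩
    · exact ⟨x', (hj'.of_le hω hc hj h).trans hω hi, hk⟩

theorem colorMerge_color (hω : IsNonCrossing ω) (hc : ∀ a b, ω a b → c a = c b) {i j : α}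
    (h : colorMerge hω hc i j) : c i = c j := by
  obtain ⟨x, hi, hj⟩ := h
  exact hi.2.1.symm.trans hj.2.1

theorem ColorCovers.of_rel (hω : IsNonCrossing ω) (hc : ∀ a b, ω a b → c a = c b) {i j : α}
    (h : ω i j) (hij : i ≤ j) : ColorCovers ω c i j := by
  refine ⟨hij, hc _ _ h, ⟨j, le_rfl, h⟩, fun s t hst hcs his hsj hjt => hcs ?_⟩
  exact (hc _ _ (hω i s j t his hsj hjt h hst)).symm.trans (hc _ _ h)

theorem le_colorMerge (hω : IsNonCrossing ω) (hc : ∀ a b, ω a b → c a = c b) :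
    ω ≤ colorMerge hω hc := by
  intro i j h
  rcases le_total i j with hij | hij
  · exact ⟨i, .refl i, .of_rel hω hc h hij⟩
  · exact ⟨j, .of_rel hω hc (ω.symm h) hij, .refl j⟩

/-- For crossing pairs of one colour, the left one of the covering points `x`, `x'` covers the
other, so all four points are merged. For different colours, the block of the right one contains an
arc that obstructs the covering by the left one. -/
theorem isNonCrossing_colorMerge (hω : IsNonCrossing ω) (hc : ∀ a b, ω a b → c a = c b) :
    IsNonCrossing (colorMerge hω hc) := by
  rintro a b p d hab hbp hpd ⟨x, hxa, hxp⟩ ⟨x', hxb, hxd⟩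
  obtain ⟨hxa', hcxa, -, hba⟩ := hxa
  obtain ⟨hxp', hcxp, ⟨y, hy, hxy⟩, hbp'⟩ := hxp
  obtain ⟨hxb', hcxb, -, hbb⟩ := hxb
  obtain ⟨hxd', hcxd, ⟨y', hy', hxy'⟩, hbd⟩ := hxd
  by_cases hcol : c a = c b
  · rcases le_total x x' with h | h
    · have : ColorCovers ω c x x' := by
        refine ⟨h, hcxa.trans (hcol.trans hcxb.symm), ⟨y, by order, hxy⟩, ?_⟩
        intro s t hst hcs hxs hsx ht
        rcases lt_trichotomy t p with htp | rfl | hpt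
        · exact hcs (hc _ _ (hω s x' t y' hsx ht (by order) hst hxy'))
        · exact hcs ((hc _ _ hst).trans (hcxp.symm.trans (hcxa.trans (hcol.trans hcxb.symm))))
        · exact hbp' s t hst (fun e => hcs (e.trans (hcxp.symm.trans (hcxa.trans
            (hcol.trans hcxb.symm))))) hxs (by order) hpt
      exact ⟨x, ⟨hxa', hcxa, ⟨y, by order, hxy⟩, hba⟩,
        this.trans hω ⟨hxb', hcxb, ⟨y', by order, hxy'⟩, hbb⟩⟩
    · have : ColorCovers ω c x' x := by
        refine ⟨h, hcxb.trans (hcol.symm.trans hcxa.symm), ⟨y', by order, hxy'⟩, ?_⟩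
        intro s t hst hcs hxs hsx ht
        rcases lt_trichotomy t p with htp | rfl | hpt
        · exact hcs (hc _ _ (hω s x t y hsx ht (by order) hst hxy))
        · exact hcs ((hc _ _ hst).trans hcxp.symm)
        · exact hbb s t hst (fun e => hcs (e.trans (hcol.symm.trans hcxa.symm))) hxs (by order)
            (by order)
      exact ⟨x', this.trans hω ⟨hxa', hcxa, ⟨y, by order, hxy⟩, hba⟩,
        ⟨hxb', hcxb, ⟨y', by order, hxy'⟩, hbb⟩⟩
  · exfalso
    have hne : x ≠ x' := by
      rintro rfl
      exact hcol (hcxa.symm.trans hcxb)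
    have hpb : c p = c a := hcxp.symm.trans hcxa
    have hyb : b < y := by order
    rcases lt_or_gt_of_ne hne with h | h
    · exact hbp' x' y' hxy' (fun e => hcol (hpb.symm.trans (e.symm.trans hcxb))) h (by order)
        (by order)
    · exact hbb x y hxy (fun e => hcol (hcxa.symm.trans e)) h (by order) hyb

/-- A merged block is spanned by its outermost constituent, the `ω`-block of the leftmost point
covering `i`. This is the source of domination in `exists_dominated`. -/
theorem exists_min_max_colorMerge [Finite α] (hω : IsNonCrossing ω)
    (hc : ∀ a b, ω a b → c a = c b) (i : α) :
    ∃ x y, ω x y ∧ colorMerge hω hc i x ∧ ∀ j, colorMerge hω hc i j → x ≤ j ∧ j ≤ y := by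
  obtain ⟨x, hx, hx'⟩ := exists_least_of_finite (fun x => ColorCovers ω c x i) (.refl i)
  obtain ⟨y, hy, hy'⟩ := exists_greatest_of_finite (fun y => ω x y) (ω.refl x)
  refine ⟨x, y, hy, ⟨x, hx, .refl x⟩, ?_⟩
  rintro j ⟨z, hzi, hzj⟩
  have hxj := (hx.of_le hω hc hzi (hx' z hzi)).trans hω hzj
  obtain ⟨w, hw, hxw⟩ := hxj.2.2.1
  exact ⟨hxj.1, hw.trans (hy' w hxw)⟩

end Merge

namespace NC

variable {n : ℕ}

/-! ### Counting blocks -/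

open Classical in
theorem card_blocks_eq_card_min (π : NC n) :
    π.blocks.card = (Finset.univ.filter fun i => ∀ j, π.Rel i j → i ≤ j).card := by
  symm
  refine Finset.card_bij (fun i _ => π.blockOf i) (fun i _ => Finset.mem_image_of_mem _
    (Finset.mem_univ i)) ?_ ?_
  · intro i hi j hj h
    have hij : π.Rel i j := by
      rw [← mem_blockOf, h, mem_blockOf]
      exact Rel.rfl
    exact le_antisymm ((Finset.mem_filter.1 hi).2 j hij) ((Finset.mem_filter.1 hj).2 i hij.symm)
  · intro W hW
    obtain ⟨i, -, rfl⟩ := Finset.mem_image.1 hW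
    obtain ⟨m, hm, hm'⟩ := π.exists_min i
    refine ⟨m, Finset.mem_filter.2 ⟨Finset.mem_univ m, fun j hj => hm' j (hm.trans hj)⟩, ?_⟩
    ext j
    rw [mem_blockOf, mem_blockOf]
    exact ⟨hm.trans, hm.symm.trans⟩

open Classical in
theorem card_blocks_eq_card_max (π : NC n) :
    π.blocks.card = (Finset.univ.filter fun i => ∀ j, π.Rel i j → j ≤ i).card := by
  symm
  refine Finset.card_bij (fun i _ => π.blockOf i) (fun i _ => Finset.mem_image_of_mem _
    (Finset.mem_univ i)) ?_ ?_
  · intro i hi j hj h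
    have hij : π.Rel i j := by
      rw [← mem_blockOf, h, mem_blockOf]
      exact Rel.rfl
    exact le_antisymm ((Finset.mem_filter.1 hj).2 i hij.symm) ((Finset.mem_filter.1 hi).2 j hij)
  · intro W hW
    obtain ⟨i, -, rfl⟩ := Finset.mem_image.1 hW
    obtain ⟨m, hm, hm'⟩ := π.exists_max i
    refine ⟨m, Finset.mem_filter.2 ⟨Finset.mem_univ m, fun j hj => hm' j (hm.trans hj)⟩, ?_⟩
    ext j
    rw [mem_blockOf, mem_blockOf]
    exact ⟨hm.trans, hm.symm.trans⟩

/-- A point is maximal in its block of the complement iff the next point is not minimal in its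
block. -/
theorem kr_max_iff {π : NC n} {w m : Fin n} (hw : ∀ x, w < x ↔ m ≤ x) :
    (∀ j, π.kr.Rel w j → j ≤ w) ↔ ¬ ∀ j, π.Rel m j → m ≤ j := by
  constructor
  · intro h hm
    obtain ⟨M, hM, hM'⟩ := π.exists_max m
    exact absurd ((hw M).2 (hm M hM)) (not_lt.2 (h M (kr_rel_of_min_max hw hM hm hM')))
  · intro h j hj
    by_contra hjw
    refine h fun b hb => ?_
    have hwj := not_le.1 hjw
    exact (hw b).1 (((kr_rel_of_le hwj.le).1 hj m b hb ((hw m).2 le_rfl) ((hw j).1 hwj)).1)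

/-- Count blocks of `π` by least elements and blocks of the complement by greatest elements. By
`kr_max_iff` each of the `n - 1` gaps between consecutive points contributes exactly one; the first
and the last point contribute one each. -/
theorem card_blocks_add_card_blocks_kr (hn : 0 < n) (π : NC n) :
    π.blocks.card + π.kr.blocks.card = n + 1 := by
  classical
  obtain ⟨k, rfl⟩ := Nat.exists_eq_succ_of_ne_zero hn.ne'
  rw [card_blocks_eq_card_min, card_blocks_eq_card_max, Finset.card_filter, Finset.card_filter,
    Fin.sum_univ_succ, Fin.sum_univ_castSucc, if_pos (fun j _ => Fin.zero_le j),
    if_pos (fun j _ => Fin.le_last j)]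
  have h : ∀ i : Fin k, (if ∀ j, π.Rel i.succ j → i.succ ≤ j then 1 else 0) +
      (if ∀ j, π.kr.Rel i.castSucc j → j ≤ i.castSucc then 1 else 0) = 1 := by
    intro i
    have := kr_max_iff (π := π) (w := i.castSucc) (m := i.succ)
      (fun x => Fin.castSucc_lt_iff_succ_le)
    simp only [this]
    split_ifs <;> rfl
  have h' := Finset.sum_congr (rfl : (Finset.univ : Finset (Fin k)) = _) fun i _ => h i
  rw [Finset.sum_add_distrib] at h'
  simp only [Finset.sum_const, Finset.card_univ, Fintype.card_fin, smul_eq_mul, mul_one] at h'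
  omega

/-! ### Domination: each block of the larger partition has its extremal elements in one block of
the smaller one -/

/-- `π ≪ σ`: `π ≤ σ`, and the least and the greatest element of each block of `σ` lie in the same
block of `π`. -/
def Dominated (π σ : NC n) : Prop :=
  π ≤ σ ∧ ∀ i, ∃ x y, π.Rel x y ∧ σ.Rel i x ∧ ∀ j, σ.Rel i j → x ≤ j ∧ j ≤ y

/-- Each point `i` must be joined in `σ'` to the least element `x` of its `σ`-block. Otherwise the
`σ'`-block of `i` is nested strictly between `x` and the greatest element `y`, and the complement of
`σ'` has a block around it whose ends, being joined by `τ`, separate `i` from `x` in `σ`. -/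
theorem Dominated.le_of {π τ σ σ' : NC n} (h : Dominated π σ) (hτ : τ ≤ σ.kr) (hπ : π ≤ σ')
    (h' : Dominated τ σ'.kr) : σ ≤ σ' := by
  rw [le_def]
  have key : ∀ i x y, π.Rel x y → σ.Rel i x → (∀ j, σ.Rel i j → x ≤ j ∧ j ≤ y) →
      σ'.Rel i x := by
    intro i x y hxy hix hext
    by_contra hne
    have hxi : x < i := lt_of_le_of_ne (hext i Rel.rfl).1 (by rintro rfl; exact hne Rel.rfl)
    have hxy' : σ'.Rel x y := hxy.mono hπ
    have hiy : i < y := lt_of_le_of_ne (hext i Rel.rfl).2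
      (by rintro rfl; exact hne hxy'.symm)
    obtain ⟨m, hm, hm'⟩ := σ'.exists_min i
    obtain ⟨M, hM, hM'⟩ := σ'.exists_max i
    have hmi := hm' i Rel.rfl
    have hiM := hM' i Rel.rfl
    have hxm : x < m := by
      rcases lt_trichotomy x m with h | rfl | h
      · exact h
      · exact absurd hm hne
      · refine absurd ((σ'.rel_of_crossing h hxi hiy hm.symm hxy').symm.trans hm.symm).symm hne
    obtain ⟨w, hw⟩ := exists_pred_of_lt hxm
    have hxw : x ≤ w := by
      by_contra h
      exact absurd ((hw x).1 (not_le.1 h)) (not_le.2 hxm)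
    have hwm : w < m := (hw m).2 le_rfl
    have hwM : σ'.kr.Rel w M := kr_rel_of_min_max hw (hm.symm.trans hM)
      (fun j hj => hm' j (hm.trans hj)) (fun j hj => hM' j (hm.trans hj))
    obtain ⟨k, l, hkl, hwk, hK⟩ := h'.2 w
    have hwl := hwk.trans (hkl.mono h'.1)
    have hkw := (hK w Rel.rfl).1
    have hMl := (hK M hwM).2
    have hwy : w < y := by order
    -- The arc from `x` to `y` in `σ'` forces `x ≤ k`. Then `(k, l]` is a union of blocks of `σ`
    -- containing `i` but not `x`.
    have h1 := (kr_rel σ' w k).1 hwk x y hxy'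
    have hσkl : σ.kr.Rel k l := hkl.mono hτ
    have hkl' : k ≤ l := by order
    by_cases hxk : x ≤ k
    · have := (kr_rel_of_le hkl').1 hσkl i x hix (by order) (by order)
      exact absurd this.1 (not_lt.2 hxk)
    · have : ¬ y ≤ w := not_le.2 hwy
      have : ¬ y ≤ k := by order
      grind
  intro i j hij
  obtain ⟨x, y, hxy, hix, hext⟩ := h.2 i
  exact (key i x y hxy hix hext).trans (key j x y hxy (hij.symm.trans hix)
    fun z hz => hext z (hij.trans hz)).symm

theorem Dominated.unique {π τ σ σ' : NC n} (h : Dominated π σ) (hτ : Dominated τ σ.kr)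
    (h' : Dominated π σ') (hτ' : Dominated τ σ'.kr) : σ = σ' :=
  le_antisymm (h.le_of hτ.1 h'.1 hτ') (h'.le_of hτ'.1 h.1 hτ)

theorem eq_of_le_of_max {κ κ' : NC n} (h : κ ≤ κ')
    (hmax : ∀ i, (∀ j, κ.Rel i j → j ≤ i) → ∀ j, κ'.Rel i j → j ≤ i) : κ = κ' := by
  refine le_antisymm h (le_def.2 fun i j hij => ?_)
  obtain ⟨M, hM, hM'⟩ := κ.exists_max i
  obtain ⟨N, hN, hN'⟩ := κ.exists_max j
  have hMN : κ'.Rel M N := (hM.mono h).symm.trans (hij.trans (hN.mono h))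
  have e : M = N := le_antisymm
    (hmax N (fun x hx => hN' x (hN.trans hx)) M hMN.symm)
    (hmax M (fun x hx => hM' x (hM.trans hx)) N hMN)
  exact hM.trans (e ▸ hN.symm)

/-! ### Existence of the intermediate partition `σ` -/

theorem interlace_false {π τ : NC n} {i j : Fin n} :
    interlace π τ (toLex (i, false)) (toLex (j, false)) ↔ π.Rel i j := by
  refine ⟨?_, fun h => Or.inl ⟨rfl, rfl, h⟩⟩
  rintro (⟨-, -, h⟩ | ⟨h, -, -⟩)
  · exact h
  · exact absurd h (by simp)

theorem interlace_true {π τ : NC n} {i j : Fin n} :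
    interlace π τ (toLex (i, true)) (toLex (j, true)) ↔ τ.Rel i j := by
  refine ⟨?_, fun h => Or.inr ⟨rfl, rfl, h⟩⟩
  rintro (⟨h, -, -⟩ | ⟨-, -, h⟩)
  · exact absurd h (by simp)
  · exact h

theorem interlace_color {π τ : NC n} {x y : Fin n ×ₗ Bool} (h : interlace π τ x y) :
    (ofLex x).2 = (ofLex y).2 := by
  rcases h with ⟨h, h', -⟩ | ⟨h, h', -⟩ <;> rw [h, h']

theorem toLex_lt_toLex_left {i j : Fin n} {b : Bool} : toLex (i, b) < toLex (j, b) ↔ i < j := by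
  simp [Prod.Lex.toLex_lt_toLex]

theorem toLex_false_lt_true {i j : Fin n} : toLex (i, false) < toLex (j, true) ↔ i ≤ j := by
  simp [Prod.Lex.toLex_lt_toLex, le_iff_lt_or_eq]

theorem toLex_true_lt_false {i j : Fin n} : toLex (i, true) < toLex (j, false) ↔ i < j := by
  simp [Prod.Lex.toLex_lt_toLex, show ¬ (true < false) by decide]

theorem toLex_le_toLex_left {i j : Fin n} {b : Bool} : toLex (i, b) ≤ toLex (j, b) ↔ i ≤ j := by
  rw [← not_lt, toLex_lt_toLex_left, not_lt]

theorem isNonCrossing_interlace {π τ : NC n} (h : τ ≤ π.kr) : IsNonCrossing (interlace π τ) := by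
  have key : ∀ x y, interlace π τ x y → interlace π π.kr x y := by
    rintro x y (h' | ⟨h1, h2, h'⟩)
    · exact Or.inl h'
    · exact Or.inr ⟨h1, h2, h'.mono h⟩
  rintro ⟨a, a'⟩ ⟨b, b'⟩ ⟨c, c'⟩ ⟨d, d'⟩ hab hbc hcd hac hbd
  have hK := π.isGreatest_kr.1 _ _ _ _ hab hbc hcd (key _ _ hac) (key _ _ hbd)
  obtain rfl : a' = b' := interlace_color hK
  obtain rfl : a' = c' := interlace_color hac
  obtain rfl : a' = d' := interlace_color hbd
  cases a'
  · exact interlace_false.2 (interlace_false.1 hK)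
  · exact interlace_true.2 (τ.rel_of_crossing (toLex_lt_toLex_left.1 hab)
      (toLex_lt_toLex_left.1 hbc) (toLex_lt_toLex_left.1 hcd) (interlace_true.1 hac)
      (interlace_true.1 hbd))

/-- Draw `π` and `τ` together on the doubled chain, colour the points by their level, and apply
`colorMerge`. The two levels of the result are `σ` and a partition `κ ≤ Kr σ`. The path from `f`
through `M` to `l` puts an arc over every gap, and this forces `κ = Kr σ`. -/
theorem exists_dominated {π τ : NC n} (h : τ ≤ π.kr) {f l M : Fin n} (hf : ∀ x, f ≤ x)
    (hl : ∀ x, x ≤ l) (hfM : π.Rel f M) (hMl : τ.Rel M l) :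
    ∃ σ, Dominated π σ ∧ Dominated τ σ.kr := by
  have hω := isNonCrossing_interlace h
  have hc : ∀ a b, interlace π τ a b → (fun x : Fin n ×ₗ Bool => (ofLex x).2) a =
      (fun x : Fin n ×ₗ Bool => (ofLex x).2) b := fun _ _ => interlace_color
  set μ := colorMerge hω hc with hμ
  have hle := le_colorMerge hω hc
  have hNC := isNonCrossing_colorMerge hω hc
  let level : Bool → NC n := fun b => ⟨μ.comap fun i => toLex (i, b), fun p q r s hpq hqr hrs =>
    hNC _ _ _ _ (toLex_lt_toLex_left.2 hpq) (toLex_lt_toLex_left.2 hqr)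
      (toLex_lt_toLex_left.2 hrs)⟩
  have hrel : ∀ b i j, (level b).Rel i j ↔ μ (toLex (i, b)) (toLex (j, b)) :=
    fun _ _ _ => Iff.rfl
  have hext : ∀ b i, ∃ x y, interlace π τ (toLex (x, b)) (toLex (y, b)) ∧ (level b).Rel i x ∧
      ∀ j, (level b).Rel i j → x ≤ j ∧ j ≤ y := by
    intro b i
    obtain ⟨⟨x, b'⟩, ⟨y, b''⟩, hxy, hix, hj⟩ := exists_min_max_colorMerge hω hc (toLex (i, b))
    obtain rfl : b = b' := colorMerge_color hω hc hix
    obtain rfl : b = b'' := interlace_color hxy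
    exact ⟨x, y, hxy, hix, fun j hij => ⟨toLex_le_toLex_left.1 (hj _ hij).1,
      toLex_le_toLex_left.1 (hj _ hij).2⟩⟩
  have hσ : Dominated π (level false) := by
    refine ⟨le_def.2 fun i j hij => hle (interlace_false.2 hij), fun i => ?_⟩
    obtain ⟨x, y, hxy, hh⟩ := hext false i
    exact ⟨x, y, interlace_false.1 hxy, hh⟩
  have hκ : Dominated τ (level true) := by
    refine ⟨le_def.2 fun i j hij => hle (interlace_true.2 hij), fun i => ?_⟩
    obtain ⟨x, y, hxy, hh⟩ := hext true i
    exact ⟨x, y, interlace_true.1 hxy, hh⟩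
  have hκσ : level true ≤ (level false).kr := by
    refine (level false).isGreatest_kr.2 (show IsNonCrossing _ from ?_)
    have e : interlace (level false) (level true) = μ := by
      ext ⟨i, b⟩ ⟨j, b'⟩
      constructor
      · intro hij
        obtain rfl : b = b' := interlace_color hij
        cases b
        · exact interlace_false.1 hij
        · exact interlace_true.1 hij
      · intro hij
        obtain rfl : b = b' := colorMerge_color hω hc hij
        cases b
        · exact interlace_false.2 hij
        · exact interlace_true.2 hij
    rw [e]
    exact hNC
  refine ⟨level false, hσ, ?_⟩
  -- It remains to exclude a gap between `w` and its successor `m` with `w` greatest in its upper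
  -- block and `m` least in its lower block.
  rw [← eq_of_le_of_max hκσ]
  · exact hκ
  intro w hw
  rcases (hl w).eq_or_lt with rfl | hwl
  · exact fun j _ => hl j
  obtain ⟨m, hwm, hm⟩ := exists_least_of_finite (fun x => w < x) hwl
  have hw' : ∀ x, w < x ↔ m ≤ x := fun x => ⟨hm x, hwm.trans_le⟩
  rw [kr_max_iff hw']
  intro hmin
  -- If the innermost arc over the gap belongs to `π`, its left end covers `m`, so `m` is not least.
  have caseA : ∀ x y, π.Rel x y → x < m → m ≤ y →
      ¬ ∀ s t, τ.Rel s t → s < m → m ≤ t → s < x := by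
    intro x y hxy hxm hmy hall
    refine absurd (hmin x ⟨toLex (x, false), ?_, .refl _⟩) (not_le.2 hxm)
    refine ⟨toLex_le_toLex_left.2 hxm.le, rfl, ⟨toLex (y, false), toLex_le_toLex_left.2 hmy,
      interlace_false.2 hxy⟩, ?_⟩
    rintro ⟨s, bs⟩ ⟨t, bt⟩ hst hcs hxs hsm hmt
    obtain rfl : bs = bt := interlace_color hst
    cases bs
    · exact hcs rfl
    · exact absurd (hall s t (interlace_true.1 hst) (toLex_true_lt_false.1 hsm)
        (toLex_false_lt_true.1 hmt)) (not_lt.2 (toLex_false_lt_true.1 hxs))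
  -- If it belongs to `τ`, then `w` is merged with it, so `w` is not greatest.
  have caseB : ∀ s t, τ.Rel s t → s < m → m ≤ t →
      ¬ ∀ x y, π.Rel x y → x < m → m ≤ y → x ≤ s := by
    intro s t hst hsm hmt hall
    have hsw : s ≤ w := by
      by_contra hsw
      exact absurd (hm s (not_le.1 hsw)) (not_le.2 hsm)
    have hwt : w < t := (hw' t).2 hmt
    have hcov : (level true).Rel w s := by
      refine ⟨toLex (s, true), ⟨toLex_le_toLex_left.2 hsw, rfl, ⟨toLex (t, true),
        toLex_le_toLex_left.2 hwt.le, interlace_true.2 hst⟩, ?_⟩, .refl _⟩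
      rintro ⟨x, bx⟩ ⟨y, bY⟩ hxy hcx hsx hxw hwy
      obtain rfl : bx = bY := interlace_color hxy
      cases bx
      · exact absurd (hall x y (interlace_false.1 hxy)
          (lt_of_le_of_lt (toLex_false_lt_true.1 hxw) hwm)
          ((hw' y).1 (toLex_true_lt_false.1 hwy))) (not_le.2 (toLex_true_lt_false.1 hsx))
      · exact hcx rfl
    exact absurd (hw t (hcov.trans (hst.mono hκ.1))) (not_le.2 hwt)
  by_cases hT : ∃ s, ∃ t, τ.Rel s t ∧ s < m ∧ m ≤ t
  · obtain ⟨s', hs'⟩ := hT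
    obtain ⟨s, ⟨t, hst, hsm, hmt⟩, hs⟩ := exists_greatest_of_finite
      (fun s => ∃ t, τ.Rel s t ∧ s < m ∧ m ≤ t) hs'
    refine caseB s t hst hsm hmt fun x y hxy hxm hmy => ?_
    by_contra hxs
    exact caseA x y hxy hxm hmy fun s' t' hst' hsm' hmt' =>
      lt_of_le_of_lt (hs s' ⟨t', hst', hsm', hmt'⟩) (not_le.1 hxs)
  · rcases le_or_gt m M with hmM | hMm
    · exact caseA f M hfM (lt_of_le_of_lt (hf w) hwm) hmM fun s t hst hs ht =>
        absurd ⟨s, t, hst, hs, ht⟩ hT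
    · exact hT ⟨M, l, hMl, hMm, hl m⟩

/-- The greatest point of the first block is joined to the last point in the complement. -/
theorem kr_rel_last {π : NC n} {f l M : Fin n} (hf : ∀ x, f ≤ x) (hl : ∀ x, x ≤ l)
    (hM : π.Rel f M) (hM' : ∀ j, π.Rel f j → j ≤ M) : π.kr.Rel M l := by
  rw [kr_rel_of_le (hl M)]
  intro a b hab hMa _
  refine ⟨?_, hl b⟩
  by_contra hb
  have := closed_of_min_max hM (fun x _ => hf x) hM' hab.symm (hf b) (not_lt.1 hb)
  exact absurd this.2 (not_le.2 hMa)

theorem exists_middle_of_rel {π ρ : NC n} (hπρ : π ≤ ρ) {f l : Fin n} (hf : ∀ x, f ≤ x)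
    (hl : ∀ x, x ≤ l) (h : ρ.Rel f l) : ∃ M, π.Rel f M ∧ (relKr π ρ).Rel M l := by
  obtain ⟨M, hM, hM'⟩ := π.exists_max f
  exact ⟨M, hM, relKr_rel.2 ⟨kr_rel_last hf hl hM hM', (hM.mono hπρ).symm.trans h⟩⟩

/-- Take `M` greatest in the first block of `σ`. The block of the last point in the complement of
`σ` has `M` as its least element, so both links are between extremal elements and descend to `π` and
`τ`. -/
theorem Dominated.exists_middle {π τ σ : NC n} (h : Dominated π σ) (hτ : Dominated τ σ.kr)
    {f l : Fin n} (hf : ∀ x, f ≤ x) (hl : ∀ x, x ≤ l) : ∃ M, π.Rel f M ∧ τ.Rel M l := by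
  obtain ⟨x, M, hxM, hfx, hM⟩ := h.2 f
  obtain rfl : x = f := le_antisymm (hM f Rel.rfl).1 (hf x)
  refine ⟨M, hxM, ?_⟩
  obtain ⟨k, y, hky, hlk, hk⟩ := hτ.2 l
  obtain rfl : y = l := le_antisymm (hl y) (hk l Rel.rfl).2
  have hMy := kr_rel_last hf hl (hxM.mono h.1) fun j hj => (hM j hj).2
  rcases (hk M hMy.symm).1.eq_or_lt with rfl | hkM
  · exact hky
  · have := (kr_rel_of_le hkM.le).1 (hlk.symm.trans hMy.symm) M x (hxM.mono h.1).symm hkM le_rfl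
    exact absurd this.1 (not_lt.2 (hf k))

/-! ### Irreducibility -/

/-- The points up to the greatest element `M` of the first block form a union of blocks, so `π`
splits after `M` unless `M` is the last point. -/
theorem isIrreducible_iff {n : ℕ+} (π : NC n) :
    π.IsIrreducible ↔ ∃ x y, π.Rel x y ∧ ∀ j, x ≤ j ∧ j ≤ y := by
  constructor
  · intro h
    by_contra hne
    let f : Fin n := ⟨0, n.pos⟩
    have hf : ∀ x, f ≤ x := fun x => Fin.le_def.2 (Nat.zero_le _)
    obtain ⟨M, hM, hM'⟩ := π.exists_max f
    have hclosed : ∀ {a b : Fin n}, π.Rel a b → a ≤ M → b ≤ M := fun hab ha =>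
      (closed_of_min_max hM (fun x _ => hf x) hM' hab (hf _) ha).2
    have hMn : (M : ℕ) + 1 < n := by
      by_contra hlt
      exact hne ⟨f, M, hM, fun j => ⟨hf j, by rw [Fin.le_def]; omega⟩⟩
    obtain ⟨n₁, n₂, hn₁, rfl⟩ : ∃ n₁ n₂ : ℕ+, (n₁ : ℕ) = M + 1 ∧ n = n₁ + n₂ :=
      ⟨⟨M + 1, Nat.succ_pos _⟩, ⟨n - (M + 1), Nat.sub_pos_of_lt hMn⟩, rfl,
        PNat.eq (Nat.add_sub_of_le hMn.le).symm⟩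
    have hcast : ∀ a : Fin n₁, Fin.castAdd n₂ a ≤ M := fun a =>
      show (a : ℕ) ≤ M by omega
    have hnat : ∀ a : Fin n₂, ¬ Fin.natAdd n₁ a ≤ M := fun a ha => by
      have : (n₁ : ℕ) + a ≤ M := ha
      omega
    let π₁ : NC n₁ := ⟨π.1.comap (Fin.castAdd n₂), fun a b c d hab hbc hcd hac hbd =>
      π.2 _ _ _ _ hab hbc hcd hac hbd⟩
    let π₂ : NC n₂ := ⟨π.1.comap (Fin.natAdd n₁), fun a b c d hab hbc hcd hac hbd =>
      π.2 _ _ _ _ (Nat.add_lt_add_left hab _) (Nat.add_lt_add_left hbc _)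
        (Nat.add_lt_add_left hcd _) hac hbd⟩
    refine h ⟨n₁, n₂, π₁, π₂, ?_⟩
    have e : concat π₁ π₂ = π := by
      refine le_antisymm (le_def.2 ?_) (le_def.2 ?_)
      · rintro i j (⟨a, b, rfl, rfl, hab⟩ | ⟨a, b, rfl, rfl, hab⟩) <;> exact hab
      · intro i j hij
        induction i using Fin.addCases with
        | left a =>
          induction j using Fin.addCases with
          | left b => exact Or.inl ⟨a, b, rfl, rfl, hij⟩
          | right b => exact absurd (hclosed hij (hcast a)) (hnat b)
        | right a =>
          induction j using Fin.addCases with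
          | left b => exact absurd (hclosed hij.symm (hcast b)) (hnat a)
          | right b => exact Or.inr ⟨a, b, rfl, rfl, hij⟩
    exact congrArg (Sigma.mk (n₁ + n₂)) e
  · rintro ⟨x, y, hxy, hext⟩ ⟨n₁, n₂, π₁, π₂, h⟩
    obtain ⟨h1, h2⟩ := Sigma.mk.inj_iff.1 h
    subst h1
    obtain rfl : concat π₁ π₂ = π := eq_of_heq h2
    have hx : (x : ℕ) ≤ 0 := (hext (Fin.castAdd n₂ ⟨0, n₁.pos⟩)).1
    have hy : (n₁ : ℕ) + 0 ≤ y := (hext (Fin.natAdd n₁ ⟨0, n₂.pos⟩)).2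
    have hn := n₁.pos
    rcases hxy with ⟨a, b, -, rfl, -⟩ | ⟨a, b, rfl, -, -⟩
    · rw [Fin.val_castAdd] at hy
      omega
    · rw [Fin.val_natAdd] at hx
      omega

end NC

namespace NC

variable {n : ℕ}

/-! ### Restriction to the blocks of a larger partition -/

theorem restrict_rel {π : NC n} {W : Finset (Fin n)} {a b : Fin W.card} :
    (π.restrict W).Rel a b ↔ π.Rel (W.orderEmbOfFin rfl a) (W.orderEmbOfFin rfl b) := Iff.rfl

theorem mem_iff_rel {σ : NC n} {W : Finset (Fin n)} (hW : W ∈ σ.blocks) {i j : Fin n}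
    (hi : i ∈ W) : j ∈ W ↔ σ.Rel i j := by
  obtain ⟨k, -, rfl⟩ := Finset.mem_image.1 hW
  rw [mem_blockOf] at *
  exact ⟨hi.symm.trans, hi.trans⟩

theorem exists_mem_of_mem_blocks {σ : NC n} {W : Finset (Fin n)} (hW : W ∈ σ.blocks) :
    ∃ i, i ∈ W := Finset.card_pos.1 (card_pos_of_mem_blocks hW)

theorem eq_of_mem_of_mem {σ : NC n} {W W' : Finset (Fin n)} (hW : W ∈ σ.blocks)
    (hW' : W' ∈ σ.blocks) {i : Fin n} (hi : i ∈ W) (hi' : i ∈ W') : W = W' := by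
  ext j
  rw [mem_iff_rel hW hi, mem_iff_rel hW' hi']

theorem blockOf_mem_blocks (σ : NC n) (i : Fin n) : σ.blockOf i ∈ σ.blocks :=
  Finset.mem_image_of_mem _ (Finset.mem_univ i)

theorem mem_blockOf_self (σ : NC n) (i : Fin n) : i ∈ σ.blockOf i :=
  (σ.mem_blockOf i i).2 Rel.rfl

theorem exists_orderEmbOfFin_eq {W : Finset (Fin n)} {i : Fin n} (hi : i ∈ W) :
    ∃ a, W.orderEmbOfFin rfl a = i := by
  have : i ∈ Set.range (W.orderEmbOfFin rfl) := by
    rw [Finset.range_orderEmbOfFin]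
    exact hi
  exact this

theorem rel_orderEmbOfFin {σ : NC n} {W : Finset (Fin n)} (hW : W ∈ σ.blocks) (a b : Fin W.card) :
    σ.Rel (W.orderEmbOfFin rfl a) (W.orderEmbOfFin rfl b) :=
  (mem_iff_rel hW (W.orderEmbOfFin_mem rfl a)).1 (W.orderEmbOfFin_mem rfl b)

theorem restrict_mono {π ρ : NC n} (h : π ≤ ρ) (W : Finset (Fin n)) :
    π.restrict W ≤ ρ.restrict W := le_def.2 fun _ _ hab => Rel.mono h hab

theorem le_of_restrict_le {π ρ σ : NC n} (hπ : π ≤ σ)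
    (h : ∀ W : σ.blocks, π.restrict W.1 ≤ ρ.restrict W.1) : π ≤ ρ := by
  rw [le_def]
  intro i j hij
  obtain ⟨a, ha⟩ := exists_orderEmbOfFin_eq (σ.mem_blockOf_self i)
  obtain ⟨b, hb⟩ := exists_orderEmbOfFin_eq ((σ.mem_blockOf i j).2 (hij.mono hπ))
  have := le_def.1 (h ⟨_, σ.blockOf_mem_blocks i⟩) a b
    (restrict_rel.2 (by rw [ha, hb]; exact hij))
  rwa [restrict_rel, ha, hb] at this

/-- The partition below `σ` with prescribed restrictions to the blocks of `σ`. -/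
def glue {σ : NC n} (p : ∀ W : σ.blocks, NC W.1.card) : NC n :=
  ⟨{ r := fun i j => ∃ (W : σ.blocks) (a b : Fin W.1.card),
        W.1.orderEmbOfFin rfl a = i ∧ W.1.orderEmbOfFin rfl b = j ∧ (p W).Rel a b
     iseqv := by
        refine ⟨fun i => ?_, ?_, ?_⟩
        · obtain ⟨a, ha⟩ := exists_orderEmbOfFin_eq (σ.mem_blockOf_self i)
          exact ⟨⟨_, σ.blockOf_mem_blocks i⟩, a, a, ha, ha, Rel.rfl⟩
        · rintro i j ⟨W, a, b, ha, hb, h⟩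
          exact ⟨W, b, a, hb, ha, h.symm⟩
        · rintro i j k ⟨W, a, b, rfl, rfl, h⟩ ⟨W', a', b', ha', rfl, h'⟩
          obtain rfl : W = W' := Subtype.ext (eq_of_mem_of_mem W.2 W'.2
            (W.1.orderEmbOfFin_mem rfl b) (ha' ▸ W'.1.orderEmbOfFin_mem rfl a'))
          obtain rfl : a' = b := (W.1.orderEmbOfFin rfl).injective ha'
          exact ⟨W, a, b', rfl, rfl, h.trans h'⟩ }, by
    rintro i j k l hij hjk hkl ⟨W, a, c, rfl, rfl, h⟩ ⟨W', b, d, rfl, rfl, h'⟩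
    have hσ := σ.rel_of_crossing hij hjk hkl (rel_orderEmbOfFin W.2 a c)
      (rel_orderEmbOfFin W'.2 b d)
    obtain rfl : W = W' := Subtype.ext (eq_of_mem_of_mem W.2 W'.2
      ((mem_iff_rel W.2 (W.1.orderEmbOfFin_mem rfl a)).2 hσ) (W'.1.orderEmbOfFin_mem rfl b))
    rw [OrderEmbedding.lt_iff_lt] at hij hjk hkl
    exact ⟨W, a, b, rfl, rfl, (p W).rel_of_crossing hij hjk hkl h h'⟩⟩

theorem glue_le {σ : NC n} (p : ∀ W : σ.blocks, NC W.1.card) : glue p ≤ σ := by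
  rw [le_def]
  rintro i j ⟨W, a, b, rfl, rfl, -⟩
  exact rel_orderEmbOfFin W.2 a b

theorem restrict_glue {σ : NC n} (p : ∀ W : σ.blocks, NC W.1.card) (W : σ.blocks) :
    (glue p).restrict W.1 = p W := by
  refine le_antisymm (le_def.2 ?_) (le_def.2 fun a b hab => ⟨W, a, b, rfl, rfl, hab⟩)
  rintro a b ⟨W', a', b', ha, hb, h⟩
  obtain rfl : W' = W := Subtype.ext (eq_of_mem_of_mem W'.2 W.2
    (W'.1.orderEmbOfFin_mem rfl a') (ha ▸ W.1.orderEmbOfFin_mem rfl a))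
  obtain rfl := (W'.1.orderEmbOfFin rfl).injective ha
  obtain rfl := (W'.1.orderEmbOfFin rfl).injective hb
  exact h

open Classical in
-- The partitions below `σ` are the families of partitions of its blocks, by `restrict` and `glue`;
-- the product of sums expands accordingly.
theorem prod_sum_restrict {R : Type*} [CommSemiring R] (σ : NC n)
    (F : ∀ W : σ.blocks, NC W.1.card → R) :
    ∏ W, ∑ x, F W x = ∑ ρ with ρ ≤ σ, ∏ W : σ.blocks, F W (ρ.restrict W.1) := by
  rw [Finset.prod_univ_sum]
  symm
  refine Finset.sum_bij' (fun ρ _ W => ρ.restrict W.1) (fun p _ => glue p) (fun _ _ => by simp)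
    (fun p _ => by simpa using glue_le p) ?_ ?_ (fun _ _ => rfl)
  · intro ρ hρ
    have hρ : ρ ≤ σ := by simpa using hρ
    refine le_antisymm (le_of_restrict_le (glue_le _) fun W => (restrict_glue _ W).le)
      (le_of_restrict_le hρ fun W => (restrict_glue (fun W => ρ.restrict W.1) W).ge)
  · intro p _
    funext W
    exact restrict_glue p W

theorem map_mem_blocks {ρ σ : NC n} (h : ρ ≤ σ) (W : σ.blocks) {V : Finset (Fin W.1.card)}
    (hV : V ∈ (ρ.restrict W.1).blocks) :
    V.map (W.1.orderEmbOfFin rfl).toEmbedding ∈ ρ.blocks := by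
  obtain ⟨a, -, rfl⟩ := Finset.mem_image.1 hV
  refine Finset.mem_image.2 ⟨W.1.orderEmbOfFin rfl a, Finset.mem_univ _, ?_⟩
  ext j
  rw [mem_blockOf, Finset.mem_map]
  constructor
  · intro hj
    obtain ⟨b, rfl⟩ := exists_orderEmbOfFin_eq
      ((mem_iff_rel W.2 (W.1.orderEmbOfFin_mem rfl a)).2 (hj.mono h))
    exact ⟨b, (mem_blockOf _ _ _).2 hj, rfl⟩
  · rintro ⟨b, hb, rfl⟩
    exact (mem_blockOf (ρ.restrict W.1) a b).1 hb

/-- The blocks of `ρ ≤ σ`, sorted by the block of `σ` that contains them. -/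
noncomputable def blocksEquiv {ρ σ : NC n} (h : ρ ≤ σ) :
    (Σ W : σ.blocks, (ρ.restrict W.1).blocks) ≃ ρ.blocks :=
  Equiv.ofBijective (fun p => ⟨p.2.1.map (p.1.1.orderEmbOfFin rfl).toEmbedding,
    map_mem_blocks h p.1 p.2.2⟩) <| by
    constructor
    · rintro ⟨W, V, hV⟩ ⟨W', V', hV'⟩ e
      have e : V.map (W.1.orderEmbOfFin rfl).toEmbedding =
        V'.map (W'.1.orderEmbOfFin rfl).toEmbedding := congrArg Subtype.val e
      obtain ⟨a, ha⟩ := exists_mem_of_mem_blocks hV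
      have ha' := Finset.mem_map_of_mem (W.1.orderEmbOfFin rfl).toEmbedding ha
      rw [e] at ha'
      obtain ⟨b, -, hb⟩ := Finset.mem_map.1 ha'
      have hb : W'.1.orderEmbOfFin rfl b = W.1.orderEmbOfFin rfl a := hb
      obtain rfl : W = W' := Subtype.ext (eq_of_mem_of_mem W.2 W'.2
        (W.1.orderEmbOfFin_mem rfl a) (hb ▸ W'.1.orderEmbOfFin_mem rfl b))
      obtain rfl : V = V' := Finset.map_injective _ e
      rfl
    · rintro ⟨V, hV⟩
      obtain ⟨i, -, rfl⟩ := Finset.mem_image.1 hV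
      obtain ⟨a, ha⟩ := exists_orderEmbOfFin_eq (σ.mem_blockOf_self i)
      refine ⟨⟨⟨_, σ.blockOf_mem_blocks i⟩, _, blockOf_mem_blocks _ a⟩, Subtype.ext ?_⟩
      refine eq_of_mem_of_mem (map_mem_blocks h ⟨_, σ.blockOf_mem_blocks i⟩
        (blockOf_mem_blocks _ a)) hV (i := i) ?_ (ρ.mem_blockOf_self i)
      exact Finset.mem_map.2 ⟨a, mem_blockOf_self _ a, ha⟩

/-- An increasing embedding is determined by its range. Stating the equality in `NCAll` lets
iterated restrictions be compared without casts between sizes. -/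
theorem mk_comap_eq {k k' : ℕ+} {π : NC n} {e : Fin k ↪o Fin n} {e' : Fin k' ↪o Fin n}
    (he : IsNonCrossing (π.1.comap e)) (he' : IsNonCrossing (π.1.comap e'))
    (h : Set.range e = Set.range e') :
    (⟨k, ⟨π.1.comap e, he⟩⟩ : NCAll) = ⟨k', ⟨π.1.comap e', he'⟩⟩ := by
  obtain rfl : k = k' := by
    apply PNat.eq
    have h1 := Set.card_range_of_injective e.injective
    have h2 := Set.card_range_of_injective e'.injective
    simp only [h, Fintype.card_fin] at h1 h2
    exact h1.symm.trans h2
  obtain rfl : e = e' := by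
    ext x
    exact congrArg Fin.val (congrFun ((StrictMono.range_inj e.strictMono e'.strictMono).1 h) x)
  rfl

theorem restrictBlock_blocksEquiv {π ρ σ : NC n} (h : ρ ≤ σ)
    (p : Σ W : σ.blocks, (ρ.restrict W.1).blocks) :
    π.restrictBlock (blocksEquiv h p) = (π.restrict p.1.1).restrictBlock p.2 := by
  refine mk_comap_eq (k := blockSize (blocksEquiv h p)) (k' := blockSize p.2) (π := π)
    (e := (blocksEquiv h p).1.orderEmbOfFin rfl)
    (e' := (p.2.1.orderEmbOfFin rfl).trans (p.1.1.orderEmbOfFin rfl)) _ _ ?_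
  have h1 : Set.range ((p.2.1.orderEmbOfFin rfl).trans (p.1.1.orderEmbOfFin rfl)) =
      p.1.1.orderEmbOfFin rfl '' Set.range (p.2.1.orderEmbOfFin rfl) :=
    Set.range_comp (p.1.1.orderEmbOfFin rfl) (p.2.1.orderEmbOfFin rfl)
  refine (Finset.range_orderEmbOfFin _ _).trans ?_
  refine Eq.trans ?_ h1.symm
  rw [Finset.range_orderEmbOfFin]
  exact Finset.coe_map _ _

theorem prod_blocks_eq {R : Type*} [CommMonoid R] (π : NC n) {ρ σ : NC n} (h : ρ ≤ σ)
    (z : NCAll → R) : ∏ V : ρ.blocks, z (π.restrictBlock V) =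
      ∏ W : σ.blocks, ∏ V : (ρ.restrict W.1).blocks, z ((π.restrict W.1).restrictBlock V) := by
  rw [← (blocksEquiv h).prod_comp, Fintype.prod_sigma]
  simp only [restrictBlock_blocksEquiv]

theorem prod_blockSize_eq {R : Type*} [CommMonoid R] {ρ σ : NC n} (h : ρ ≤ σ) (lam : ℕ+ → R) :
    ∏ V : ρ.blocks, lam (blockSize V) =
      ∏ W : σ.blocks, ∏ V : (ρ.restrict W.1).blocks, lam (blockSize V) :=
  prod_blocks_eq ρ h fun a => lam a.1

theorem card_blocks_eq_sum {ρ σ : NC n} (h : ρ ≤ σ) :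
    ρ.blocks.card = ∑ W : σ.blocks, (ρ.restrict W.1).blocks.card := by
  rw [← Fintype.card_coe, ← Fintype.card_congr (blocksEquiv h), Fintype.card_sigma]
  simp only [Fintype.card_coe]

theorem sum_card_blocks (σ : NC n) : ∑ W : σ.blocks, W.1.card = n := by
  have h := Finset.card_eq_sum_card_image σ.blockOf Finset.univ
  rw [Finset.card_univ, Fintype.card_fin] at h
  refine (Finset.sum_coe_sort σ.blocks fun W => W.card).trans (Eq.trans ?_ h.symm)
  refine Finset.sum_congr rfl fun W hW => congrArg _ ?_
  ext i
  simp only [Finset.mem_filter, Finset.mem_univ, true_and]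
  constructor
  · intro hi
    exact eq_of_mem_of_mem hW (σ.blockOf_mem_blocks i) hi (σ.mem_blockOf_self i) |>.symm
  · rintro rfl
    exact σ.mem_blockOf_self i

/-- Blocks of `π` outside `W` impose no condition: as `ρ` is non-crossing, they cannot leave an
interval between two points of `W`. -/
theorem restrict_relKr {π ρ : NC n} (h : π ≤ ρ) (W : ρ.blocks) :
    (relKr π ρ).restrict W.1 = (π.restrict W.1).kr := by
  have key : ∀ a b : Fin W.1.card, a < b →
      ((relKr π ρ).Rel (W.1.orderEmbOfFin rfl a) (W.1.orderEmbOfFin rfl b) ↔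
        (π.restrict W.1).kr.Rel a b) := by
    intro a b hab
    have hab' : W.1.orderEmbOfFin rfl a < W.1.orderEmbOfFin rfl b :=
      (OrderEmbedding.lt_iff_lt _).2 hab
    have hρ := rel_orderEmbOfFin W.2 a b
    rw [relKr_rel, kr_rel_of_le hab'.le, kr_rel_of_le hab.le, and_iff_left hρ]
    constructor
    · intro hc x y hxy hax hxb
      have := hc _ _ hxy ((OrderEmbedding.lt_iff_lt _).2 hax) ((OrderEmbedding.le_iff_le _).2 hxb)
      rwa [OrderEmbedding.lt_iff_lt, OrderEmbedding.le_iff_le] at this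
    · intro hc x y hxy hax hxb
      by_cases hx : x ∈ W.1
      · have hy : y ∈ W.1 := (mem_iff_rel W.2 hx).2 (hxy.mono h)
        obtain ⟨x, rfl⟩ := exists_orderEmbOfFin_eq hx
        obtain ⟨y, rfl⟩ := exists_orderEmbOfFin_eq hy
        rw [OrderEmbedding.lt_iff_lt, OrderEmbedding.le_iff_le] at *
        exact hc x y hxy hax hxb
      · have hxy' := hxy.mono h
        have hmem : ∀ c, ρ.Rel (W.1.orderEmbOfFin rfl c) x → False := fun c hcx =>
          hx ((mem_iff_rel W.2 (W.1.orderEmbOfFin_mem rfl c)).2 hcx)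
        have hxb' : x < W.1.orderEmbOfFin rfl b :=
          lt_of_le_of_ne hxb (by rintro rfl; exact hmem b Rel.rfl)
        constructor
        · by_contra hy
          rcases (not_lt.1 hy).eq_or_lt with rfl | hy
          · exact hmem a hxy'.symm
          · exact hmem a ((ρ.rel_of_crossing hy hax hxb' hxy'.symm hρ).symm.trans hxy'.symm)
        · by_contra hy
          exact hmem a (ρ.rel_of_crossing hax hxb' (not_le.1 hy) hρ hxy')
  exact le_antisymm (le_of_rel_of_lt fun a b hab hr => (key a b hab).1 hr)
    (le_of_rel_of_lt fun a b hab hr => (key a b hab).2 hr)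

theorem card_blocks_add_card_blocks_relKr {π ρ : NC n} (h : π ≤ ρ) :
    π.blocks.card + (relKr π ρ).blocks.card = n + ρ.blocks.card := by
  rw [card_blocks_eq_sum h, card_blocks_eq_sum (relKr_le π ρ), ← Finset.sum_add_distrib]
  simp only [restrict_relKr h]
  rw [Finset.sum_congr rfl fun W _ => card_blocks_add_card_blocks_kr
    (card_pos_of_mem_blocks W.2) (π.restrict W.1), Finset.sum_add_distrib, sum_card_blocks]
  simp

theorem forall_isIrreducible_iff {π σ : NC n} (h : π ≤ σ) :
    (∀ W : σ.blocks, (π.restrictBlock W).2.IsIrreducible) ↔ Dominated π σ := by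
  constructor
  · refine fun H => ⟨h, fun i => ?_⟩
    obtain ⟨x, y, hxy, hj⟩ := (isIrreducible_iff _).1 (H ⟨_, σ.blockOf_mem_blocks i⟩)
    refine ⟨_, _, restrict_rel.1 hxy, (mem_blockOf _ _ _).1 (Finset.orderEmbOfFin_mem (σ.blockOf i) rfl x),
      fun j hij => ?_⟩
    obtain ⟨b, rfl⟩ := exists_orderEmbOfFin_eq ((mem_blockOf _ _ _).2 hij)
    exact ⟨(OrderEmbedding.le_iff_le _).2 (hj b).1, (OrderEmbedding.le_iff_le _).2 (hj b).2⟩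
  · refine fun H W => (isIrreducible_iff _).2 ?_
    obtain ⟨i, hi⟩ := exists_mem_of_mem_blocks W.2
    obtain ⟨x, y, hxy, hix, hj⟩ := H.2 i
    obtain ⟨a, rfl⟩ := exists_orderEmbOfFin_eq ((mem_iff_rel W.2 hi).2 hix)
    obtain ⟨b, rfl⟩ := exists_orderEmbOfFin_eq ((mem_iff_rel W.2 hi).2 (hix.trans (hxy.mono h)))
    refine ⟨a, b, hxy, fun c => ?_⟩
    have := hj _ ((mem_iff_rel W.2 hi).1 (W.1.orderEmbOfFin_mem rfl c))
    exact ⟨(OrderEmbedding.le_iff_le _).1 this.1, (OrderEmbedding.le_iff_le _).1 this.2⟩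

end NC

/-! ### Inverses in incidence algebras -/

section Inverse

variable {𝕜 α : Type*} [Ring 𝕜] [PartialOrder α] [LocallyFiniteOrder α] [DecidableEq α]

/-- The left inverse of an element of the incidence algebra with unit diagonal, as a function. -/
def leftInvFun (f : IncidenceAlgebra 𝕜 α) (a b : α) : 𝕜 :=
  if a = b then 1 else -∑ x ∈ (Finset.Ico a b).attach, leftInvFun f a x.1 * f x.1 b
termination_by (Finset.Icc a b).card
decreasing_by
  have hx := Finset.mem_Ico.1 x.2
  refine Finset.card_lt_card (Finset.ssubset_iff_of_subset
    (Finset.Icc_subset_Icc_right hx.2.le) |>.2 ⟨b, ?_, ?_⟩)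
  · exact Finset.right_mem_Icc.2 (hx.1.trans hx.2.le)
  · exact fun h => absurd (Finset.mem_Icc.1 h).2 hx.2.not_ge

theorem leftInvFun_self (f : IncidenceAlgebra 𝕜 α) (a : α) : leftInvFun f a a = 1 := by
  rw [leftInvFun, if_pos rfl]

theorem leftInvFun_of_ne (f : IncidenceAlgebra 𝕜 α) {a b : α} (h : a ≠ b) :
    leftInvFun f a b = -∑ x ∈ Finset.Ico a b, leftInvFun f a x * f x b := by
  rw [leftInvFun, if_neg h, Finset.sum_attach (Finset.Ico a b) fun x => leftInvFun f a x * f x b]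

theorem exists_left_inverse (f : IncidenceAlgebra 𝕜 α) (hf : ∀ a, f a a = 1) :
    ∃ g : IncidenceAlgebra 𝕜 α, (∀ a, g a a = 1) ∧ g * f = 1 := by
  refine ⟨⟨leftInvFun f, fun a b hab => ?_⟩, leftInvFun_self f, ?_⟩
  · rw [leftInvFun_of_ne f (fun h => hab h.le), Finset.Ico_eq_empty (fun h => hab h.le),
      Finset.sum_empty, neg_zero]
  · ext a b hab
    rw [IncidenceAlgebra.mul_apply, IncidenceAlgebra.one_apply]
    change ∑ x ∈ Finset.Icc a b, leftInvFun f a x * f x b = _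
    rw [← Finset.Ico_insert_right hab, Finset.sum_insert Finset.right_notMem_Ico, hf, mul_one]
    split_ifs with h
    · subst h
      rw [Finset.Ico_self, Finset.sum_empty, add_zero, leftInvFun_self]
    · rw [leftInvFun_of_ne f h, neg_add_cancel]

/-- The left inverse again has unit diagonal, hence a left inverse of its own, which must be `f`. -/
theorem isUnit_of_diag_eq_one (f : IncidenceAlgebra 𝕜 α) (hf : ∀ a, f a a = 1) : IsUnit f := by
  obtain ⟨g, hg, hgf⟩ := exists_left_inverse f hf
  obtain ⟨h, -, hhg⟩ := exists_left_inverse g hg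
  have e : h = f := by rw [← mul_one h, ← hgf, ← mul_assoc, hhg, one_mul]
  exact ⟨⟨f, g, e ▸ hhg, hgf⟩, rfl⟩

end Inverse

/-! ### Semi-multiplicative functions -/

open NC

theorem sigma_le_iff {n : ℕ+} {π σ : NC n} : (⟨n, π⟩ : NCAll) ≤ ⟨n, σ⟩ ↔ π ≤ σ :=
  Sigma.mk_le_mk_iff

theorem incidence_apply_eq_zero (f : IncidenceAlgebra ℂ NCAll) {n : ℕ+} {π σ : NC n}
    (h : ¬ π ≤ σ) : f ⟨n, π⟩ ⟨n, σ⟩ = 0 :=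
  f.apply_eq_zero_of_not_le fun h' => h (sigma_le_iff.1 h')

theorem conv_apply (f g : IncidenceAlgebra ℂ NCAll) {n : ℕ+} (π σ : NC n) :
    (f * g) ⟨n, π⟩ ⟨n, σ⟩ = ∑ ρ : NC n, f ⟨n, π⟩ ⟨n, ρ⟩ * g ⟨n, ρ⟩ ⟨n, σ⟩ := by
  rw [IncidenceAlgebra.mul_apply]
  have h := Finset.sum_map Finset.univ (Function.Embedding.sigmaMk n)
    fun x : NCAll => f ⟨n, π⟩ x * g x ⟨n, σ⟩
  refine Eq.trans (Finset.sum_subset ?_ ?_) h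
  · rintro x hx
    obtain ⟨h1, h2⟩ := Finset.mem_Icc.1 hx
    obtain ⟨_, _, ρ, _⟩ := h1
    exact Finset.mem_map_of_mem (Function.Embedding.sigmaMk n) (Finset.mem_univ ρ)
  · rintro x - hx
    by_cases h1 : ⟨n, π⟩ ≤ x
    · by_cases h2 : x ≤ ⟨n, σ⟩
      · exact absurd (Finset.mem_Icc.2 ⟨h1, h2⟩) hx
      · rw [g.apply_eq_zero_of_not_le h2, mul_zero]
    · rw [f.apply_eq_zero_of_not_le h1, zero_mul]

/-- The relation `π ≤ ρ` is not assumed: if it fails, it fails on some block of `σ` and both sides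
vanish. This lets convolutions be summed over all of `NC n`. -/
theorem semiMultiplicative_apply {f : IncidenceAlgebra ℂ NCAll} (hf : f ∈ semiMultiplicative)
    {n : ℕ+} {π ρ σ : NC n} (hπ : π ≤ σ) (hρ : ρ ≤ σ) :
    f ⟨n, π⟩ ⟨n, ρ⟩ = ∏ W : σ.blocks, f (π.restrictBlock W) (ρ.restrictBlock W) := by
  by_cases h : π ≤ ρ
  · rw [hf.2 n π ρ h]
    refine (prod_blocks_eq π hρ fun a => f a (one a.1)).trans ?_
    exact Finset.prod_congr rfl fun W _ =>
      (hf.2 (blockSize W) (π.restrict W.1) (ρ.restrict W.1) (restrict_mono h W.1)).symm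
  · rw [incidence_apply_eq_zero f h]
    obtain ⟨W, hW⟩ : ∃ W : σ.blocks, ¬ π.restrict W.1 ≤ ρ.restrict W.1 := by
      by_contra hne
      exact h (le_of_restrict_le hπ fun W => not_not.1 (not_exists.1 hne W))
    exact (Finset.prod_eq_zero (Finset.mem_univ W)
      (incidence_apply_eq_zero f (n := blockSize W) hW)).symm

theorem semiMultiplicative_mul {f g : IncidenceAlgebra ℂ NCAll} (hf : f ∈ semiMultiplicative)
    (hg : g ∈ semiMultiplicative) : f * g ∈ semiMultiplicative := by
  classical
  refine ⟨?_, ?_⟩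
  · rintro a
    rw [IncidenceAlgebra.mul_apply, Finset.Icc_self, Finset.sum_singleton, hf.1, hg.1, mul_one]
  · intro n π σ h
    have h1 : ∀ W : σ.blocks, (f * g) (π.restrictBlock W) (one (blockSize W)) =
        ∑ x : NC W.1.card, f (π.restrictBlock W) ⟨blockSize W, x⟩ *
          g ⟨blockSize W, x⟩ (one (blockSize W)) := fun W =>
      conv_apply f g (n := blockSize W) (π.restrict W.1) ⊤
    rw [conv_apply, Finset.prod_congr rfl fun W _ => h1 W, prod_sum_restrict, Finset.sum_filter]
    refine Finset.sum_congr rfl fun ρ _ => ?_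
    split_ifs with hρ
    · rw [semiMultiplicative_apply hf h hρ, hg.2 n ρ σ hρ, ← Finset.prod_mul_distrib]
      rfl
    · rw [incidence_apply_eq_zero g hρ, mul_zero]

theorem semiMultiplicative_ext {f g : IncidenceAlgebra ℂ NCAll} (hf : f ∈ semiMultiplicative)
    (hg : g ∈ semiMultiplicative)
    (h : ∀ (n : ℕ+) (π : NC n), f ⟨n, π⟩ (one n) = g ⟨n, π⟩ (one n)) : f = g := by
  ext a b hab
  obtain ⟨n, π, σ, hle⟩ := hab
  rw [hf.2 n π σ hle, hg.2 n π σ hle]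
  exact Finset.prod_congr rfl fun W _ => h _ _

/-! ### Multiplicative functions -/

theorem kr_top (n : ℕ) : (⊤ : NC n).kr = ⊥ := by
  obtain ⟨π, hπ⟩ := kr_bijective.2 (⊥ : NC n)
  exact le_bot_iff.1 (hπ ▸ kr_antitone le_top)

theorem kr_bot (n : ℕ) : (⊥ : NC n).kr = ⊤ := by
  obtain ⟨π, hπ⟩ := kr_bijective.2 (⊤ : NC n)
  exact top_le_iff.1 (hπ ▸ kr_antitone bot_le)

theorem restrictBlock_bot {n : ℕ} {σ : NC n} (W : σ.blocks) :
    (⊥ : NC n).restrictBlock W = zero (blockSize W) := by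
  refine congrArg (Sigma.mk (blockSize W)) (le_bot_iff.1 (le_def.2 fun a b hab => ?_))
  have h : W.1.orderEmbOfFin rfl a = W.1.orderEmbOfFin rfl b := hab
  obtain rfl := (W.1.orderEmbOfFin rfl).injective h
  exact Rel.rfl

theorem blockSize_bot {n : ℕ} (W : (⊥ : NC n).blocks) : blockSize W = 1 := by
  obtain ⟨W, hW⟩ := W
  obtain ⟨i, -, rfl⟩ := Finset.mem_image.1 hW
  refine PNat.eq (show ((⊥ : NC n).blockOf i).card = 1 from Finset.card_eq_one.2 ⟨i, ?_⟩)
  ext j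
  rw [mem_blockOf, Finset.mem_singleton]
  exact ⟨fun h => Eq.symm h, fun h => Eq.symm h⟩

theorem multiplicative_apply_one {f : IncidenceAlgebra ℂ NCAll} (hf : f ∈ multiplicative)
    {n : ℕ+} (π : NC n) :
    f ⟨n, π⟩ (one n) = ∏ W : π.kr.blocks, f (zero (blockSize W)) (one (blockSize W)) := by
  rw [hf.2 n π]
  refine (hf.1.2 n ⊥ π.kr bot_le).trans (Finset.prod_congr rfl fun W _ => ?_)
  rw [restrictBlock_bot]

/-- The multiplicative function with `f(0_n, 1_n) = λ_n`. -/
noncomputable def ofSequence (lam : ℕ+ → ℂ) : IncidenceAlgebra ℂ NCAll :=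
  ofValues fun a => ∏ W : a.2.kr.blocks, lam (blockSize W)

theorem ofSequence_one (lam : ℕ+ → ℂ) {n : ℕ+} (π : NC n) :
    ofSequence lam ⟨n, π⟩ (one n) = ∏ W : π.kr.blocks, lam (blockSize W) :=
  ofValues_one _ n π

theorem prod_blocks_top {R : Type*} [CommMonoid R] (n : ℕ+) (lam : ℕ+ → R) :
    ∏ W : (⊤ : NC n).blocks, lam (blockSize W) = lam n := by
  have h : ∀ W : (⊤ : NC n).blocks, blockSize W = n := fun W =>
    congrArg Sigma.fst (restrictBlock_top (⊤ : NC n) W)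
  simp only [h]
  rw [Finset.prod_const, Finset.card_univ, Fintype.card_coe, card_blocks_top, pow_one]

theorem ofSequence_zero_one (lam : ℕ+ → ℂ) (n : ℕ+) :
    ofSequence lam (zero n) (one n) = lam n := by
  refine (ofSequence_one lam (⊥ : NC n)).trans ?_
  rw [kr_bot]
  exact prod_blocks_top n lam

theorem ofSequence_semiMultiplicative {lam : ℕ+ → ℂ} (h : lam 1 = 1) :
    ofSequence lam ∈ semiMultiplicative := by
  refine ofValues_mem _ fun n => ?_
  change ∏ W : (⊤ : NC n).kr.blocks, lam (blockSize W) = 1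
  -- The blocks of `Kr(1_n) = 0_n` are singletons, so the unit diagonal amounts to `lam 1 = 1`.
  rw [kr_top]
  exact Finset.prod_eq_one fun W _ => by rw [blockSize_bot, h]

theorem ofSequence_mem {lam : ℕ+ → ℂ} (h : lam 1 = 1) : ofSequence lam ∈ multiplicative := by
  have hs := ofSequence_semiMultiplicative h
  refine ⟨hs, fun n π => ?_⟩
  rw [ofSequence_one]
  refine Eq.trans (Finset.prod_congr rfl fun W _ => ?_) (hs.2 n ⊥ π.kr bot_le).symm
  rw [restrictBlock_bot, ofSequence_zero_one]

theorem multiplicative_one_eq_one {f : IncidenceAlgebra ℂ NCAll} (hf : f ∈ multiplicative) :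
    f (zero 1) (one 1) = 1 := by
  have h : zero 1 = one 1 := congrArg (Sigma.mk (1 : ℕ+)) (le_antisymm bot_le
    (le_def.2 fun i j _ => show i = j from Subsingleton.elim (α := Fin 1) i j))
  rw [h, hf.1.1]

theorem eq_ofSequence {f : IncidenceAlgebra ℂ NCAll} (hf : f ∈ multiplicative) :
    f = ofSequence fun k => f (zero k) (one k) :=
  semiMultiplicative_ext hf.1 (ofSequence_semiMultiplicative (multiplicative_one_eq_one hf))
    fun n π => by rw [multiplicative_apply_one hf, ofSequence_one]

open NC

/-! ### The functions `u_q` -/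

theorem NC.card_blocks_antitone {n : ℕ} {π σ : NC n} (h : π ≤ σ) :
    σ.blocks.card ≤ π.blocks.card := by
  rw [card_blocks_eq_sum h, card_blocks_eq_sum (le_refl σ)]
  refine Finset.sum_le_sum fun W _ => ?_
  have h1 : σ.restrict W.1 = ⊤ :=
    eq_of_heq (Sigma.mk.inj_iff.1 (restrictBlock_self σ W)).2
  have h2 := card_blocks_top (blockSize W)
  have h3 : (σ.restrict W.1).blocks.card = 1 := by rw [h1]; exact h2
  rw [h3, Nat.one_le_iff_ne_zero, Finset.card_ne_zero]
  obtain ⟨i, hi⟩ := exists_mem_of_mem_blocks W.2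
  obtain ⟨a, -⟩ := exists_orderEmbOfFin_eq hi
  exact ⟨_, blockOf_mem_blocks _ a⟩

theorem NC.card_blocks_pos {n : ℕ} (hn : 0 < n) (π : NC n) : 0 < π.blocks.card :=
  Finset.card_pos.2 ⟨_, blockOf_mem_blocks π ⟨0, hn⟩⟩

theorem NC.sum_card_blocks_sub_one {n : ℕ} {π σ : NC n} (h : π ≤ σ) :
    ∑ W : σ.blocks, ((π.restrict W.1).blocks.card - 1) = π.blocks.card - σ.blocks.card := by
  rw [card_blocks_eq_sum h, Finset.sum_tsub_distrib _ fun W _ =>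
    card_blocks_pos (card_pos_of_mem_blocks W.2) (π.restrict W.1)]
  simp

open Classical in
-- Irreducibility on every block of `σ` is domination, and the exponents on the blocks add up to
-- `|π| - |σ|`.
theorem uFun_apply (q : ℝ) {n : ℕ+} (π σ : NC n) :
    uFun q ⟨n, π⟩ ⟨n, σ⟩ =
      if Dominated π σ then (q : ℂ) ^ (π.blocks.card - σ.blocks.card) else 0 := by
  by_cases h : π ≤ σ
  · rw [(uFun_mem q).2 n π σ h, ← sum_card_blocks_sub_one h, ← Finset.prod_pow_eq_pow_sum,
      ← forall_isIrreducible_iff h]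
    refine (Finset.prod_congr rfl fun W _ =>
      uFun_one q (blockSize W) (π.restrict W.1)).trans ?_
    rw [Finset.prod_ite_zero]
    simp only [Finset.mem_univ, true_imp_iff]
    congr 1
  · rw [incidence_apply_eq_zero _ h, if_neg fun h' => h h'.1]

/-- The product `∏_{V ∈ π} λ_{|V|}`. -/
noncomputable def sizeProd (lam : ℕ+ → ℂ) {n : ℕ} (π : NC n) : ℂ :=
  ∏ V : π.blocks, lam (blockSize V)

theorem theta_eq_sum (q : ℝ) (lam : ℕ+ → ℂ) (n : ℕ+) :
    theta q lam n = ∑ π : NC n, uFun q ⟨n, π⟩ (one n) * sizeProd lam π := by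
  classical
  rw [theta, Finset.sum_filter]
  refine Finset.sum_congr rfl fun π _ => ?_
  rw [uFun_one, ite_mul, zero_mul]
  rfl

theorem sizeProd_theta (q : ℝ) (lam : ℕ+ → ℂ) {n : ℕ+} (κ : NC n) :
    sizeProd (theta q lam) κ = ∑ τ : NC n, uFun q ⟨n, τ⟩ ⟨n, κ⟩ * sizeProd lam τ := by
  classical
  have h := Finset.prod_congr (rfl : (Finset.univ : Finset κ.blocks) = _) fun W _ =>
    theta_eq_sum q lam (blockSize W)
  refine h.trans ((prod_sum_restrict κ fun W x => uFun q ⟨blockSize W, x⟩ (one (blockSize W)) *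
    sizeProd lam x).trans ?_)
  rw [Finset.sum_filter]
  refine Finset.sum_congr rfl fun τ _ => ?_
  split_ifs with hτ
  · rw [(uFun_mem q).2 n τ κ hτ, sizeProd, prod_blockSize_eq hτ, ← Finset.prod_mul_distrib]
    rfl
  · rw [incidence_apply_eq_zero _ hτ, zero_mul]

open Classical in
theorem multiplicative_apply {f : IncidenceAlgebra ℂ NCAll} (hf : f ∈ multiplicative) {n : ℕ+}
    (π ρ : NC n) : f ⟨n, π⟩ ⟨n, ρ⟩ =
      if π ≤ ρ then sizeProd (fun k => f (zero k) (one k)) (relKr π ρ) else 0 := by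
  split_ifs with h
  · rw [hf.1.2 n π ρ h, sizeProd,
      prod_blockSize_eq (relKr_le π ρ) fun k => f (zero k) (one k)]
    refine Finset.prod_congr rfl fun W _ => ?_
    refine (multiplicative_apply_one hf (n := blockSize W) (π.restrict W.1)).trans ?_
    change sizeProd (fun k => f (zero k) (one k)) (π.restrict W.1).kr =
      sizeProd (fun k => f (zero k) (one k)) ((relKr π ρ).restrict W.1)
    rw [restrict_relKr h]
  · exact incidence_apply_eq_zero f h

/-- The partitions `ρ ≥ π` that are irreducible correspond to the pairs `(σ, τ)` with `π ≪ σ` and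
`τ ≪ Kr σ`, where `τ` is the complement of `π` relative to `ρ`. -/
theorem sum_irreducible_eq_sum_dominated (q : ℝ) {n : ℕ+} (π : NC n) (F : NC n → ℂ) :
    ∑ ρ : NC n, (open Classical in if π ≤ ρ then F (relKr π ρ) else 0) *
        uFun q ⟨n, ρ⟩ ⟨n, ⊤⟩ =
      ∑ σ : NC n, uFun q ⟨n, π⟩ ⟨n, σ⟩ * ∑ τ : NC n, uFun q ⟨n, τ⟩ ⟨n, σ.kr⟩ * F τ := by
  classical
  have hL : ∀ ρ : NC n, (if π ≤ ρ then F (relKr π ρ) else 0) * uFun q ⟨n, ρ⟩ ⟨n, ⊤⟩ =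
      if π ≤ ρ ∧ Dominated ρ ⊤ then
        (q : ℂ) ^ (ρ.blocks.card - (⊤ : NC n).blocks.card) * F (relKr π ρ) else 0 := by
    intro ρ
    rw [uFun_apply]
    by_cases h1 : π ≤ ρ <;> by_cases h2 : Dominated ρ ⊤ <;> simp [h1, h2, mul_comm]
  have hR : ∀ σ τ : NC n, uFun q ⟨n, π⟩ ⟨n, σ⟩ * (uFun q ⟨n, τ⟩ ⟨n, σ.kr⟩ * F τ) =
      if Dominated π σ ∧ Dominated τ σ.kr then (q : ℂ) ^ ((π.blocks.card - σ.blocks.card) +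
        (τ.blocks.card - σ.kr.blocks.card)) * F τ else 0 := by
    intro σ τ
    rw [uFun_apply, uFun_apply]
    by_cases h1 : Dominated π σ <;> by_cases h2 : Dominated τ σ.kr <;>
      simp [h1, h2, pow_add, mul_assoc]
  simp only [Finset.mul_sum, hL, hR]
  rw [← Finset.sum_product' Finset.univ Finset.univ fun σ τ : NC n =>
    if Dominated π σ ∧ Dominated τ σ.kr then (q : ℂ) ^ ((π.blocks.card - σ.blocks.card) +
        (τ.blocks.card - σ.kr.blocks.card)) * F τ else 0]
  rw [← Finset.sum_filter, ← Finset.sum_filter]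
  have hex : ∀ ρ : NC n, ρ ∈ Finset.univ.filter (fun ρ => π ≤ ρ ∧ Dominated ρ ⊤) →
      ∃ σ, Dominated π σ ∧ Dominated (relKr π ρ) σ.kr := by
    intro ρ hρ
    obtain ⟨hπρ, hρ⟩ := (Finset.mem_filter.1 hρ).2
    obtain ⟨f, l, hfl, -, hext⟩ := hρ.2 ⟨0, n.pos⟩
    obtain ⟨M, hfM, hMl⟩ := exists_middle_of_rel hπρ (fun x => (hext x trivial).1)
      (fun x => (hext x trivial).2) hfl
    exact exists_dominated (relKr_le_kr π ρ) (fun x => (hext x trivial).1)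
      (fun x => (hext x trivial).2) hfM hMl
  choose s hs using hex
  -- The second component alone gives injectivity; for surjectivity, uniqueness of `σ` identifies
  -- the chosen `s ρ hρ` with the given one.
  refine Finset.sum_bij (fun ρ hρ => (s ρ hρ, relKr π ρ)) ?_ ?_ ?_ ?_
  · intro ρ hρ
    simpa using hs ρ hρ
  · intro ρ hρ ρ' hρ' h
    exact relKr_injective (Finset.mem_filter.1 hρ).2.1 (Finset.mem_filter.1 hρ').2.1
      (congrArg Prod.snd h)
  · rintro ⟨σ, τ⟩ h
    obtain ⟨hσ, hτ⟩ : Dominated π σ ∧ Dominated τ σ.kr := by simpa using h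
    obtain ⟨ρ, hπρ, rfl⟩ := exists_relKr_eq (hτ.1.trans (kr_antitone hσ.1))
    have hf : ∀ x : Fin n, (⟨0, n.pos⟩ : Fin n) ≤ x := fun x => Nat.zero_le _
    have hl : ∀ x : Fin n, x ≤ (⟨n - 1, Nat.sub_lt n.pos one_pos⟩ : Fin n) := fun x =>
      Nat.le_sub_one_of_lt x.2
    obtain ⟨M, hfM, hMl⟩ := hσ.exists_middle hτ hf hl
    have hρ : ρ ∈ Finset.univ.filter (fun ρ => π ≤ ρ ∧ Dominated ρ ⊤) :=
      Finset.mem_filter.2 ⟨Finset.mem_univ ρ, hπρ, le_top, fun i =>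
        ⟨_, _, (hfM.mono hπρ).trans (hMl.mono (relKr_le π ρ)), trivial,
          fun j _ => ⟨hf j, hl j⟩⟩⟩
    exact ⟨ρ, hρ, Prod.ext ((hs ρ hρ).1.unique (hs ρ hρ).2 hσ hτ) rfl⟩
  · intro ρ hρ
    obtain ⟨hσ, hτ⟩ := hs ρ hρ
    -- The two counting identities match the exponents; the inequalities `h3`, `h4`, `h6` make the
    -- truncated subtractions genuine.
    have h1 := card_blocks_add_card_blocks_relKr (Finset.mem_filter.1 hρ).2.1
    have h2 := card_blocks_add_card_blocks_kr n.pos (s ρ hρ)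
    have h3 := card_blocks_antitone hσ.1
    have h4 := card_blocks_antitone hτ.1
    have h5 := card_blocks_top n
    have h6 := card_blocks_pos n.pos ρ
    congr 2
    change _ = (π.blocks.card - (s ρ hρ).blocks.card) +
      ((relKr π ρ).blocks.card - (s ρ hρ).kr.blocks.card)
    omega

/-! ### Solving `θ(λ) = μ` -/

open Classical in
/-- The sequence `λ` with `θ(λ) = μ`. -/
noncomputable def thetaInv (q : ℝ) (mu : ℕ+ → ℂ) (n : ℕ+) : ℂ :=
  mu n - ∑ π : NC n with π.IsIrreducible ∧ π ≠ ⊤, (q : ℂ) ^ (π.blocks.card - 1) *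
    -- The test serves termination only: for `π ≠ ⊤` every block has fewer than `n` points, so the
    -- value `0` is never used.
    ∏ V : π.blocks, if _h : blockSize V < n then thetaInv q mu (blockSize V) else 0
termination_by n

theorem NC.blockSize_lt {n : ℕ+} {π : NC n} (hπ : π ≠ ⊤) (V : π.blocks) : blockSize V < n := by
  refine show V.1.card < (n : ℕ) from ?_
  refine lt_of_le_of_ne ((Finset.card_le_univ V.1).trans (Fintype.card_fin _).le) fun h => hπ ?_
  have hV : V.1 = Finset.univ :=
    (Finset.card_eq_iff_eq_univ V.1).1 (h.trans (Fintype.card_fin _).symm)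
  refine top_unique (le_def.2 fun i j _ => ?_)
  exact (mem_iff_rel V.2 (hV ▸ Finset.mem_univ i)).1 (hV ▸ Finset.mem_univ j)

theorem theta_eq_add (q : ℝ) (lam : ℕ+ → ℂ) (n : ℕ+) : theta q lam n = lam n +
    (open Classical in ∑ π : NC n with π.IsIrreducible ∧ π ≠ ⊤, (q : ℂ) ^ (π.blocks.card - 1) *
      ∏ V : π.blocks, lam (blockSize V)) := by
  classical
  have h : (⊤ : NC n) ∈ Finset.univ.filter (fun π : NC n => π.IsIrreducible) :=
    Finset.mem_filter.2 ⟨Finset.mem_univ _, isIrreducible_top n⟩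
  rw [theta, ← Finset.add_sum_erase _ _ h, prod_blocks_top, card_blocks_top, Nat.sub_self, pow_zero,
    one_mul]
  congr 1
  refine Finset.sum_congr ?_ fun _ _ => rfl
  ext π
  simp [and_comm]

theorem theta_thetaInv (q : ℝ) (mu : ℕ+ → ℂ) : theta q (thetaInv q mu) = mu := by
  classical
  funext n
  rw [theta_eq_add, thetaInv, sub_add_eq_add_sub, sub_eq_iff_eq_add]
  congr 1
  refine Finset.sum_congr rfl fun π hπ => ?_
  congr 1
  refine Finset.prod_congr rfl fun V _ => ?_
  rw [dif_pos (blockSize_lt (Finset.mem_filter.1 hπ).2.2 V)]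

theorem theta_apply_one (q : ℝ) (lam : ℕ+ → ℂ) : theta q lam 1 = lam 1 := by
  classical
  rw [theta_eq_add, Finset.sum_eq_zero, add_zero]
  intro π hπ
  exact absurd (blockSize_lt (Finset.mem_filter.1 hπ).2.2
    ⟨_, π.blockOf_mem_blocks ⟨0, one_pos⟩⟩) not_lt_one

/-! ### The conjugation identity and the theorem -/

/-- Conjugation in a form free of inverses. At `(π, 1_n)` it becomes
`sum_irreducible_eq_sum_dominated` for the weight `∏ λ`. -/
theorem mul_uFun_eq_uFun_mul (q : ℝ) {f : IncidenceAlgebra ℂ NCAll} (hf : f ∈ multiplicative) :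
    f * uFun q = uFun q * ofSequence (theta q fun k => f (zero k) (one k)) := by
  refine semiMultiplicative_ext (semiMultiplicative_mul hf.1 (uFun_mem q))
    (semiMultiplicative_mul (uFun_mem q) (ofSequence_semiMultiplicative
      ((theta_apply_one q _).trans (multiplicative_one_eq_one hf)))) fun n π => ?_
  refine (conv_apply _ _ π ⊤).trans (Eq.trans ?_ (conv_apply _ _ π ⊤).symm)
  have h1 : ∀ σ : NC n, ofSequence (theta q fun k => f (zero k) (one k)) ⟨n, σ⟩ ⟨n, ⊤⟩ =
      ∑ τ : NC n, uFun q ⟨n, τ⟩ ⟨n, σ.kr⟩ * sizeProd (fun k => f (zero k) (one k)) τ :=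
    fun σ => (ofSequence_one _ σ).trans (sizeProd_theta q _ σ.kr)
  simp only [multiplicative_apply hf, h1]
  exact sum_irreducible_eq_sum_dominated q π _

theorem theorem10p1 (q : ℝ) :
    ∃ u : (IncidenceAlgebra ℂ NCAll)ˣ,
      (u : IncidenceAlgebra ℂ NCAll) = uFun q ∧
      (∀ f ∈ multiplicative,
        (↑u⁻¹ * f * ↑u : IncidenceAlgebra ℂ NCAll) ∈ multiplicative ∧
        ∀ (n : ℕ+) (π : NC n),
          (↑u⁻¹ * f * ↑u : IncidenceAlgebra ℂ NCAll) ⟨n, π⟩ (NC.one n) =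
            ∏ W : π.kr.blocks,
              theta q (fun k => f (NC.zero k) (NC.one k)) (NC.blockSize W)) ∧
      (fun f : IncidenceAlgebra ℂ NCAll => ↑u⁻¹ * f * ↑u) '' multiplicative = multiplicative := by
  obtain ⟨u, hu⟩ := isUnit_of_diag_eq_one (uFun q) (uFun_mem q).1
  have hconj : ∀ f ∈ multiplicative, (↑u⁻¹ * f * ↑u : IncidenceAlgebra ℂ NCAll) =
      ofSequence (theta q fun k => f (zero k) (one k)) := by
    intro f hf
    rw [mul_assoc, hu, mul_uFun_eq_uFun_mul q hf, ← hu, Units.inv_mul_cancel_left]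
  have hmem : ∀ f ∈ multiplicative,
      (↑u⁻¹ * f * ↑u : IncidenceAlgebra ℂ NCAll) ∈ multiplicative := by
    intro f hf
    rw [hconj f hf]
    exact ofSequence_mem ((theta_apply_one q _).trans (multiplicative_one_eq_one hf))
  refine ⟨u, hu, fun f hf => ⟨hmem f hf, fun n π => ?_⟩, Set.Subset.antisymm ?_ ?_⟩
  · rw [hconj f hf, ofSequence_one]
  · rintro _ ⟨f, hf, rfl⟩
    exact hmem f hf
  · intro g hg
    have h1 := theta_thetaInv q fun k => g (zero k) (one k)
    -- The preimage of `g` comes from solving the triangular system for `λ`; as `θ_1 = λ_1`, the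
    -- normalization is inherited from `g`.
    have hlam : thetaInv q (fun k => g (zero k) (one k)) 1 = 1 := by
      rw [← theta_apply_one q (thetaInv q _), h1]
      exact multiplicative_one_eq_one hg
    refine ⟨ofSequence (thetaInv q fun k => g (zero k) (one k)), ofSequence_mem hlam, ?_⟩
    refine (hconj _ (ofSequence_mem hlam)).trans ?_
    simp only [ofSequence_zero_one]
    rw [h1]
    exact (eq_ofSequence hg).symm
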